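/- Let $\Sigma\subset\mathbb{C}$ be a closed (possibly unbounded) set and let $t>0$. For a positive Borel measure $\sigma$ on $\mathbb{C}$ write $V^\sigma(z)=\int\log\frac{1}{|z-w|}\,d\sigma(w)$ and $I(\sigma)=\iint\log\frac{1}{|z-w|}\,d\sigma(z)\,d\sigma(w)$. The logarithmic capacity of a set $E\subset\mathbb{C}$ is $\sup_\nu e^{-I(\nu)}$, the supremum being over the Borel probability measures $\nu$ carried by a compact subset of $E$; "quasi-everywhere" means outside a set of capacity $0$. Let $Q:\Sigma\to(-\infty,+\infty]$ be a weakly admissible external field for the mass $t$, that is, $Q$ is lower semicontinuous, the set $\{z\in\Sigma: Q(z)<+\infty\}$ has positive capacity, and, in case $\Sigma$ is unbounded, $$\liminf_{|z|\to\infty,\ z\in\Sigma}\bigl(Q(z)-t\log|z|\bigr)>-\infty .$$ For a measure $\sigma$ on $\Sigma$ of total mass $t$ put $$I_Q(\sigma)=\iint\Bigl(\log\frac{1}{|z-w|}+\frac{Q(z)}{t}+\frac{Q(w)}{t}\Bigr)d\sigma(z)\,d\sigma(w)\in(-\infty,+\infty].$$ Let $\mu$ be a positive Borel measure on $\Sigma$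 of total mass $t$ and of finite energy $I(\mu)$ (that is, the double integral $I(\mu)$ is well defined and finite), and suppose that there is a constant $C\in\mathbb{R}$ such that $$V^\mu(z)+Q(z)\ge C\quad\text{for quasi-every } z\in\Sigma,\qquad V^\mu(z)+Q(z)\le C\quad\text{for quasi-every } z\in\operatorname{supp}\mu .$$ Then $\mu=\mu_Q$, the equilibrium measure in the external field $Q$: $\mu$ minimizes $I_Q$ among all positive Borel measures on $\Sigma$ of total mass $t$, and it is the only minimizer. -/

import Mathlib

open MeasureTheory Filter Topology
open scoped ENNReal

namespace WeightedPotential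

noncomputable section

/-- The integral of an extended-real function: `∫ f⁺ - ∫ f⁻` in `[-∞, +∞]`
(an undetermined `∞ - ∞` is given the value `-∞`, so that the integral is finite exactly when
both parts are). -/
def eintegral {α : Type*} [MeasurableSpace α] (μ : Measure α) (f : α → EReal) : EReal :=
  ((∫⁻ x, (f x).toENNReal ∂μ : ℝ≥0∞) : EReal) - ((∫⁻ x, (-f x).toENNReal ∂μ : ℝ≥0∞) : EReal)

/-- The logarithmic kernel `log (1 / |z - w|)`, equal to `+∞` on the diagonal. -/
def logKernel (z w : ℂ) : EReal := -ENNReal.log ‖z - w‖ₑ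

/-- The logarithmic potential `V^μ(z) = -∫ log |z - w| dμ(w)`. -/
def potential (μ : Measure ℂ) (z : ℂ) : EReal := eintegral μ (logKernel z)

/-- The logarithmic energy `I(μ) = -∬ log |z - w| dμ(z) dμ(w)`. -/
def logEnergy (μ : Measure ℂ) : EReal :=
  eintegral (μ.prod μ) (fun p => logKernel p.1 p.2)

/-- `I(μ)` is a real number. -/
def HasFiniteEnergy (μ : Measure ℂ) : Prop := logEnergy μ ≠ ⊥ ∧ logEnergy μ ≠ ⊤

/-- The logarithmic capacity `sup_ν exp (-I(ν))`, the supremum being over the Borel probability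
measures `ν` carried by a compact subset of `E`. -/
def logCapacity (E : Set ℂ) : ℝ≥0∞ :=
  ⨆ (ν : Measure ℂ) (_ : IsProbabilityMeasure ν)
    (_ : ∃ K : Set ℂ, IsCompact K ∧ K ⊆ E ∧ ν Kᶜ = 0), EReal.exp (-logEnergy ν)

/-- `p` holds at every point of `S` outside a set of capacity zero. -/
def QuasiEverywhereOn (S : Set ℂ) (p : ℂ → Prop) : Prop :=
  logCapacity {z ∈ S | ¬ p z} = 0

/-- `Q` is a weakly admissible external field on `S` for the mass `t`. Only the values of `Q` on
`S` matter. If `S` is bounded, the condition at infinity is void. -/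
structure IsWeaklyAdmissible (S : Set ℂ) (t : ℝ) (Q : ℂ → EReal) : Prop where
  ne_bot : ∀ z ∈ S, Q z ≠ ⊥
  lowerSemicontinuousOn : LowerSemicontinuousOn Q S
  capacity_pos : 0 < logCapacity {z ∈ S | Q z < ⊤}
  growth : ⊥ < liminf (fun z : ℂ => Q z - ((t * Real.log ‖z‖ : ℝ) : EReal))
    (Bornology.cobounded ℂ ⊓ 𝓟 S)

/-- The weighted energy `I_Q(σ) = ∬ (log (1 / |z - w|) + Q(z) / t + Q(w) / t) dσ(z) dσ(w)` of a
measure of mass `t`. -/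
def weightedEnergy (t : ℝ) (Q : ℂ → EReal) (σ : Measure ℂ) : EReal :=
  eintegral (σ.prod σ) (fun p => logKernel p.1 p.2 + Q p.1 / (t : EReal) + Q p.2 / (t : EReal))

/-- `μ` is a positive Borel measure on `S` with total mass `t`. -/
def IsMeasureOnWithMass (S : Set ℂ) (t : ℝ) (μ : Measure ℂ) : Prop :=
  μ Sᶜ = 0 ∧ μ Set.univ = ENNReal.ofReal t

/-- `μ` minimizes the weighted energy among all measures on `S` of total mass `t`. -/
def IsEquilibriumMeasure (S : Set ℂ) (t : ℝ) (Q : ℂ → EReal) (μ : Measure ℂ) : Prop :=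
  IsMeasureOnWithMass S t μ ∧
    ∀ ν : Measure ℂ, IsMeasureOnWithMass S t ν → weightedEnergy t Q μ ≤ weightedEnergy t Q ν

end

end WeightedPotential

/-! Formally, `I_Q(ν) - I_Q(μ) = I(ν - μ) + 2 ∫ (V^μ + Q) d(ν - μ)`. A measure of finite energy does
not charge sets of capacity zero (`measure_eq_zero_of_logCapacity_eq_zero`), so the lower bound on
`V^μ + Q` holds `ν`-a.e. and the upper bound `μ`-a.e., and the last term is nonnegative. Since `ν -
μ` has total mass zero, `I(ν - μ)` is nonnegative and vanishes only for `ν = μ`.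

To keep `∞ - ∞` out, everything is written with the nonnegative `sphericalKernel`. Admissibility
gives `Q / t + m = weight + P` on `S` with `P ≥ 0` (`exists_excess`), so that `I_Q` is a `[0,
∞]`-valued energy minus a finite constant (`weightedEnergy_eq_sub`), and `V^μ + Q` becomes the
spherical potential plus `t P`, up to a constant (`potential_add_field`).

Strict positivity comes from writing `log ((r² + b) / (r² + a))`, with `r = |z - w|`, as a
superposition of products of Gaussian bumps in `z` and in `w`. The energy of a difference is then a
weighted integral of squares, `gaussGap`. Letting `a → 0` and `b → ∞` yields
`two_mul_mutualEnergy_add_le`, where a fixed `gaussGap` survives as remainder; if it is zero, the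
measures agree after convolution with a Gaussian, hence agree (`eq_of_gaussGap_eq_zero`). -/

namespace WeightedPotential

/-! ### Gaussian decomposition of the logarithm -/

/-- The Gaussian bump `exp (-2 s |z - x|²)` centred at `x`. -/
noncomputable def gauss (s : ℝ) (x z : ℂ) : ℝ≥0∞ :=
  ENNReal.ofReal (Real.exp (-(2 * s * ‖z - x‖ ^ 2)))

/-- The density of the Gaussian decomposition of `log ((r² + b) / (r² + a))`. -/
noncomputable def gaussWeight (a b s : ℝ) : ℝ≥0∞ :=
  ∫⁻ u in Set.Ioc a b, ENNReal.ofReal (4 * s / Real.pi * Real.exp (-(s * u)))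

lemma measurable_gauss : Measurable (fun q : (ℝ × ℂ) × ℂ => gauss q.1.1 q.1.2 q.2) := by
  unfold gauss
  fun_prop

lemma measurable_gaussWeight (a b : ℝ) : Measurable (gaussWeight a b) := by
  unfold gaussWeight
  refine Measurable.lintegral_prod_right' (f := fun q : ℝ × ℝ =>
    ENNReal.ofReal (4 * q.1 / Real.pi * Real.exp (-(q.1 * q.2)))) ?_
  fun_prop

lemma gauss_le_one {s : ℝ} (hs : 0 ≤ s) (x z : ℂ) : gauss s x z ≤ 1 := by
  unfold gauss
  rw [← ENNReal.ofReal_one]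
  apply ENNReal.ofReal_le_ofReal
  rw [Real.exp_le_one_iff]
  have : 0 ≤ 2 * s * ‖z - x‖ ^ 2 := by positivity
  linarith

lemma gaussWeight_pos {a b s : ℝ} (hab : a < b) (hs : 0 < s) : 0 < gaussWeight a b s := by
  unfold gaussWeight
  rw [lintegral_pos_iff_support (by fun_prop)]
  have : Function.support (fun u : ℝ => ENNReal.ofReal (4 * s / Real.pi * Real.exp (-(s * u))))
      = Set.univ := by
    ext u
    simp only [Function.mem_support, Set.mem_univ, iff_true, ne_eq, ENNReal.ofReal_eq_zero, not_le]
    positivity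
  rw [this]
  simpa using hab

lemma gaussWeight_mono {a b a' b' : ℝ} (ha : a' ≤ a) (hb : b ≤ b') (s : ℝ) :
    gaussWeight a b s ≤ gaussWeight a' b' s :=
  lintegral_mono_set (Set.Ioc_subset_Ioc ha hb)

lemma integrable_exp_neg_mul_norm_sq {c : ℝ} (hc : 0 < c) (m : ℂ) :
    Integrable (fun x : ℂ => Real.exp (-(c * ‖x - m‖ ^ 2))) := by
  have h := GaussianFourier.integrable_cexp_neg_mul_sq_norm_add (V := ℂ)
    (b := (c : ℂ)) (by simpa using hc) 0 0
  have h2 := (h.norm).comp_sub_right m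
  refine h2.congr (Eventually.of_forall fun x => ?_)
  simp only [Complex.norm_exp]
  congr 1
  simp [← Complex.ofReal_pow, ← Complex.ofReal_neg, ← Complex.ofReal_mul]

lemma lintegral_exp_neg_mul_norm_sq {c : ℝ} (hc : 0 < c) (m : ℂ) :
    ∫⁻ x : ℂ, ENNReal.ofReal (Real.exp (-(c * ‖x - m‖ ^ 2))) = ENNReal.ofReal (Real.pi / c) := by
  rw [← ofReal_integral_eq_lintegral_ofReal (integrable_exp_neg_mul_norm_sq hc m)
    (Eventually.of_forall fun x => (Real.exp_pos _).le)]
  congr 1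
  rw [integral_sub_right_eq_self (fun x : ℂ => Real.exp (-(c * ‖x‖ ^ 2))) m]
  have := GaussianFourier.integral_rexp_neg_mul_sq_norm (V := ℂ) hc
  simpa [Complex.finrank_real_complex] using this

/-- Parallelogram law: `|z - x|² + |w - x|² = 2 |x - (z + w) / 2|² + |z - w|² / 2`. -/
lemma lintegral_gauss_mul_gauss {s : ℝ} (hs : 0 < s) (z w : ℂ) :
    ∫⁻ x, gauss s x z * gauss s x w
      = ENNReal.ofReal (Real.pi / (4 * s)) * ENNReal.ofReal (Real.exp (-(s * ‖z - w‖ ^ 2))) := by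
  have key : ∀ x : ℂ, gauss s x z * gauss s x w =
      ENNReal.ofReal (Real.exp (-(s * ‖z - w‖ ^ 2))) *
        ENNReal.ofReal (Real.exp (-(4 * s * ‖x - (z + w) / 2‖ ^ 2))) := by
    intro x
    unfold gauss
    rw [← ENNReal.ofReal_mul (Real.exp_pos _).le, ← ENNReal.ofReal_mul (Real.exp_pos _).le,
      ← Real.exp_add, ← Real.exp_add]
    congr 2
    simp only [← Complex.normSq_eq_norm_sq, Complex.normSq_apply]
    simp
    ring
  simp_rw [key]
  rw [lintegral_const_mul _ (by fun_prop), lintegral_exp_neg_mul_norm_sq (by positivity), mul_comm]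

lemma lintegral_Ioi_exp_neg {c : ℝ} (hc : 0 < c) :
    ∫⁻ s in Set.Ioi (0 : ℝ), ENNReal.ofReal (Real.exp (-(s * c))) = ENNReal.ofReal (1 / c) := by
  have h1 : IntegrableOn (fun s : ℝ => Real.exp (-(s * c))) (Set.Ioi 0) := by
    have := integrableOn_exp_mul_Ioi (a := -c) (by linarith) 0
    refine this.congr_fun (fun s _ => ?_) measurableSet_Ioi
    ring_nf
  rw [← ofReal_integral_eq_lintegral_ofReal h1 (Eventually.of_forall fun x => (Real.exp_pos _).le)]
  congr 1
  have := integral_exp_mul_Ioi (a := -c) (by linarith) 0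
  simp only [mul_zero, Real.exp_zero, neg_div_neg_eq] at this
  rw [← this]
  congr 1
  ext s
  ring_nf

lemma lintegral_Ioc_one_div {a b r : ℝ} (ha : 0 < a) (hab : a ≤ b) (hr : 0 ≤ r) :
    ∫⁻ u in Set.Ioc a b, ENNReal.ofReal (1 / (u + r))
      = ENNReal.ofReal (Real.log ((r + b) / (r + a))) := by
  have hint : IntervalIntegrable (fun u : ℝ => 1 / (u + r)) volume a b := by
    apply ContinuousOn.intervalIntegrable
    apply ContinuousOn.div continuousOn_const (by fun_prop)
    intro u hu
    rw [Set.uIcc_of_le hab] at hu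
    have : 0 < u := ha.trans_le hu.1
    positivity
  rw [← ofReal_integral_eq_lintegral_ofReal]
  · congr 1
    rw [← intervalIntegral.integral_of_le hab,
      intervalIntegral.integral_comp_add_right (fun u => 1 / u) r,
      integral_one_div_of_pos (by positivity) (by linarith)]
    rw [add_comm b, add_comm a]
  · exact (intervalIntegrable_iff_integrableOn_Ioc_of_le hab).1 hint
  · filter_upwards [ae_restrict_mem measurableSet_Ioc] with u hu
    have : 0 < u := ha.trans hu.1
    simp only [Pi.zero_apply]
    positivity

/-- With `r = |z - w|`, the logarithm is `∫ du / (u + r²)` over `(a, b]`, and `1 / (u + r²)` is the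
Laplace integral of `exp (-s (u + r²))`. The factor `4 s / π` in `gaussWeight` cancels the constant
of `lintegral_gauss_mul_gauss`. -/
lemma ofReal_log_eq_lintegral_gauss {a b : ℝ} (ha : 0 < a) (hab : a ≤ b) (z w : ℂ) :
    ENNReal.ofReal (Real.log ((‖z - w‖ ^ 2 + b) / (‖z - w‖ ^ 2 + a))) =
      ∫⁻ q, gaussWeight a b q.1 * (gauss q.1 q.2 z * gauss q.1 q.2 w)
        ∂((volume.restrict (Set.Ioi (0 : ℝ))).prod (volume : Measure ℂ)) := by
  have hg1 : ∀ z, Measurable (fun q : ℝ × ℂ => gauss q.1 q.2 z) := fun z =>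
    measurable_gauss.comp (measurable_id.prodMk measurable_const)
  rw [lintegral_prod _ (by
    exact (((measurable_gaussWeight a b).comp measurable_fst).mul ((hg1 z).mul (hg1 w))).aemeasurable)]
  rw [← lintegral_Ioc_one_div ha hab (by positivity)]
  have e1 : ∀ u ∈ Set.Ioc a b, ENNReal.ofReal (1 / (u + ‖z - w‖ ^ 2)) =
      ∫⁻ s in Set.Ioi (0 : ℝ), ENNReal.ofReal (Real.exp (-(s * (u + ‖z - w‖ ^ 2)))) := by
    intro u hu
    have := hu.1
    have : 0 < u := by linarith
    rw [lintegral_Ioi_exp_neg (by positivity)]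
  rw [setLIntegral_congr_fun measurableSet_Ioc e1, lintegral_lintegral_swap (by fun_prop)]
  refine setLIntegral_congr_fun measurableSet_Ioi fun s hs => ?_
  have hs : 0 < s := hs
  have hg2 : ∀ z, Measurable (fun x : ℂ => gauss s x z) := fun z =>
    (hg1 z).comp (measurable_const.prodMk measurable_id)
  simp only
  rw [lintegral_const_mul (gaussWeight a b s) (f := fun x => gauss s x z * gauss s x w)
    ((hg2 z).mul (hg2 w)), lintegral_gauss_mul_gauss hs, gaussWeight,
    ← lintegral_mul_const _ (by fun_prop)]
  refine lintegral_congr fun u => ?_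
  rw [← ENNReal.ofReal_mul (by positivity), ← ENNReal.ofReal_mul (by positivity)]
  congr 1
  rw [mul_add, neg_add, Real.exp_add]
  have := Real.pi_pos
  field_simp

/-- The Gaussian average of a measure. -/
noncomputable def gaussAvg (σ : Measure ℂ) (q : ℝ × ℂ) : ℝ≥0∞ := ∫⁻ z, gauss q.1 q.2 z ∂σ

lemma measurable_gaussAvg (σ : Measure ℂ) [SFinite σ] : Measurable (gaussAvg σ) :=
  measurable_gauss.lintegral_prod_right

lemma lintegral_lintegral_log_eq {a b : ℝ} (ha : 0 < a) (hab : a ≤ b) (σ τ : Measure ℂ)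
    [SFinite σ] [SFinite τ] :
    ∫⁻ z, ∫⁻ w, ENNReal.ofReal (Real.log ((‖z - w‖ ^ 2 + b) / (‖z - w‖ ^ 2 + a))) ∂τ ∂σ =
      ∫⁻ q, gaussWeight a b q.1 * (gaussAvg σ q * gaussAvg τ q)
        ∂((volume.restrict (Set.Ioi (0 : ℝ))).prod (volume : Measure ℂ)) := by
  set ρ := (volume.restrict (Set.Ioi (0 : ℝ))).prod (volume : Measure ℂ)
  have hW : Measurable (fun q : ℝ × ℂ => gaussWeight a b q.1) :=
    (measurable_gaussWeight a b).comp measurable_fst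
  have hg1 : ∀ z, Measurable (fun q : ℝ × ℂ => gauss q.1 q.2 z) := fun z =>
    measurable_gauss.comp (measurable_id.prodMk measurable_const)
  have hg2 : ∀ q : ℝ × ℂ, Measurable (fun z : ℂ => gauss q.1 q.2 z) := fun q =>
    measurable_gauss.comp (measurable_const.prodMk measurable_id)
  have inner : ∀ z, ∫⁻ w, ENNReal.ofReal (Real.log ((‖z - w‖ ^ 2 + b) / (‖z - w‖ ^ 2 + a))) ∂τ =
      ∫⁻ q, gaussWeight a b q.1 * gauss q.1 q.2 z * gaussAvg τ q ∂ρ := by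
    intro z
    simp_rw [ofReal_log_eq_lintegral_gauss ha hab]
    rw [lintegral_lintegral_swap]
    · refine lintegral_congr fun q => ?_
      rw [gaussAvg, ← lintegral_const_mul _ (hg2 q)]
      simp only [mul_assoc]
    · refine Measurable.aemeasurable ?_
      exact (hW.comp measurable_snd).mul (((hg1 z).comp measurable_snd).mul
        (measurable_gauss.comp (measurable_snd.prodMk measurable_fst)))
  simp_rw [inner]
  rw [lintegral_lintegral_swap]
  · refine lintegral_congr fun q => ?_
    rw [lintegral_mul_const _ ((hg2 q).const_mul _), lintegral_const_mul _ (hg2 q), mul_assoc]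
    rfl
  · refine Measurable.aemeasurable ?_
    exact ((hW.comp measurable_snd).mul
        (measurable_gauss.comp (measurable_snd.prodMk measurable_fst))).mul
        ((measurable_gaussAvg τ).comp measurable_snd)

/-- The Gaussian energy of the difference of two measures. -/
noncomputable def gaussGap (a b : ℝ) (μ ν : Measure ℂ) : ℝ≥0∞ :=
  ∫⁻ q, gaussWeight a b q.1 *
      ENNReal.ofReal (((gaussAvg μ q).toReal - (gaussAvg ν q).toReal) ^ 2)
    ∂((volume.restrict (Set.Ioi (0 : ℝ))).prod (volume : Measure ℂ))

lemma gaussGap_mono {a b a' b' : ℝ} (ha : a' ≤ a) (hb : b ≤ b') (μ ν : Measure ℂ) :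
    gaussGap a b μ ν ≤ gaussGap a' b' μ ν :=
  lintegral_mono fun q => by gcongr; exact gaussWeight_mono ha hb q.1

lemma gaussAvg_ne_top {s : ℝ} (hs : 0 ≤ s) (σ : Measure ℂ) [IsFiniteMeasure σ] (x : ℂ) :
    gaussAvg σ (s, x) ≠ ⊤ := by
  refine ne_of_lt ((lintegral_mono (g := fun _ => 1) fun z => gauss_le_one hs x z).trans_lt ?_)
  simp

lemma ae_fst_pos : ∀ᵐ q ∂((volume.restrict (Set.Ioi (0 : ℝ))).prod (volume : Measure ℂ)),
    0 < q.1 :=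
  Measure.quasiMeasurePreserving_fst.ae (ae_restrict_mem measurableSet_Ioi)

/-- This is `x² + y² = 2 x y + (x - y)²` for the Gaussian averages, integrated; it is arranged as a
sum because the energies live in `[0, ∞]`. -/
lemma energy_add_energy_eq {a b : ℝ} (ha : 0 < a) (hab : a ≤ b) (μ ν : Measure ℂ)
    [IsFiniteMeasure μ] [IsFiniteMeasure ν] :
    (∫⁻ z, ∫⁻ w, ENNReal.ofReal (Real.log ((‖z - w‖ ^ 2 + b) / (‖z - w‖ ^ 2 + a))) ∂μ ∂μ) +
      (∫⁻ z, ∫⁻ w, ENNReal.ofReal (Real.log ((‖z - w‖ ^ 2 + b) / (‖z - w‖ ^ 2 + a))) ∂ν ∂ν) =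
    2 * (∫⁻ z, ∫⁻ w, ENNReal.ofReal (Real.log ((‖z - w‖ ^ 2 + b) / (‖z - w‖ ^ 2 + a))) ∂ν ∂μ) +
      gaussGap a b μ ν := by
  simp only [lintegral_lintegral_log_eq ha hab]
  have hW : Measurable (fun q : ℝ × ℂ => gaussWeight a b q.1) :=
    (measurable_gaussWeight a b).comp measurable_fst
  have hμ := measurable_gaussAvg μ
  have hν := measurable_gaussAvg ν
  rw [gaussGap, ← lintegral_const_mul _ (by fun_prop), ← lintegral_add_left (by fun_prop),
    ← lintegral_add_left (by fun_prop)]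
  refine lintegral_congr_ae ?_
  filter_upwards [ae_fst_pos] with q hq
  have h1 := gaussAvg_ne_top hq.le μ q.2
  have h2 := gaussAvg_ne_top hq.le ν q.2
  simp only [Prod.mk.eta] at h1 h2
  rw [← mul_add, mul_left_comm, ← mul_add]
  congr 1
  rw [← ENNReal.ofReal_toReal h1, ← ENNReal.ofReal_toReal h2]
  have p1 : 0 ≤ (gaussAvg μ q).toReal := ENNReal.toReal_nonneg
  have p2 : 0 ≤ (gaussAvg ν q).toReal := ENNReal.toReal_nonneg
  rw [show (2 : ℝ≥0∞) = ENNReal.ofReal 2 by simp]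
  rw [← ENNReal.ofReal_mul p1, ← ENNReal.ofReal_mul p1, ← ENNReal.ofReal_mul p2,
    ← ENNReal.ofReal_mul (by norm_num), ← ENNReal.ofReal_add (by positivity) (by positivity),
    ENNReal.toReal_ofReal p1, ENNReal.toReal_ofReal p2,
    ← ENNReal.ofReal_add (by positivity) (by positivity)]
  congr 1
  ring


/-- The weight is positive for `s > 0`, so the averages agree for almost every `(s, x)`; Fubini then
provides one good scale `s`. -/
lemma gaussAvg_ae_eq_of_gaussGap_eq_zero {a b : ℝ} (hab : a < b) (μ ν : Measure ℂ)
    [IsFiniteMeasure μ] [IsFiniteMeasure ν] (h : gaussGap a b μ ν = 0) :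
    ∃ s : ℝ, 0 < s ∧ ∀ᵐ x : ℂ, gaussAvg μ (s, x) = gaussAvg ν (s, x) := by
  have hW : Measurable (fun q : ℝ × ℂ => gaussWeight a b q.1) :=
    (measurable_gaussWeight a b).comp measurable_fst
  have hμ := measurable_gaussAvg μ
  have hν := measurable_gaussAvg ν
  rw [gaussGap, lintegral_eq_zero_iff (by fun_prop)] at h
  have h2 : ∀ᵐ q ∂((volume.restrict (Set.Ioi (0 : ℝ))).prod (volume : Measure ℂ)),
      gaussAvg μ q = gaussAvg ν q := by
    filter_upwards [h, ae_fst_pos] with q hq hq0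
    have h1 := gaussAvg_ne_top hq0.le μ q.2
    have h2 := gaussAvg_ne_top hq0.le ν q.2
    simp only [Prod.mk.eta] at h1 h2
    simp only [Pi.zero_apply, mul_eq_zero, (gaussWeight_pos hab hq0).ne', false_or,
      ENNReal.ofReal_eq_zero] at hq
    have := pow_eq_zero_iff (two_ne_zero) |>.1 (le_antisymm hq (sq_nonneg _))
    exact (ENNReal.toReal_eq_toReal_iff' h1 h2).1 (sub_eq_zero.1 this)
  have h3 := Measure.ae_ae_of_ae_prod h2
  have h4 := h3.and (ae_restrict_mem measurableSet_Ioi)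
  have : NeBot (ae (volume.restrict (Set.Ioi (0 : ℝ)))) := by
    rw [ae_neBot, Ne, Measure.restrict_eq_zero]
    simp
  obtain ⟨s, hs1, hs2⟩ := h4.exists
  exact ⟨s, hs2, hs1⟩

/-! ### Injectivity of Gaussian convolution -/

/-- The Gaussian measure with density `exp (-2 s |x|²)`. -/
noncomputable def gaussMeasure (s : ℝ) : Measure ℂ := volume.withDensity (fun x => gauss s x 0)

lemma isFiniteMeasure_gaussMeasure {s : ℝ} (hs : 0 < s) : IsFiniteMeasure (gaussMeasure s) := by
  refine isFiniteMeasure_withDensity ?_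
  have := lintegral_exp_neg_mul_norm_sq (c := 2 * s) (by positivity) 0
  simp only [gauss, norm_sub_rev (0 : ℂ)]
  rw [this]
  exact ENNReal.ofReal_ne_top

lemma charFun_gaussMeasure_ne_zero {s : ℝ} (hs : 0 < s) (ξ : ℂ) :
    charFun (gaussMeasure s) ξ ≠ 0 := by
  have hm : Measurable (fun x : ℂ => gauss s x 0) := by unfold gauss; fun_prop
  rw [charFun_apply, gaussMeasure, integral_withDensity_eq_integral_toReal_smul hm
    (Eventually.of_forall fun x => ENNReal.ofReal_lt_top)]
  have h := GaussianFourier.integral_cexp_neg_mul_sq_norm_add (V := ℂ)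
    (b := ((2 * s : ℝ) : ℂ)) (by simpa using hs) Complex.I ξ
  have e : ∀ x : ℂ, (gauss s x 0).toReal • Complex.exp (inner ℝ x ξ * Complex.I) =
      Complex.exp (-((2 * s : ℝ) : ℂ) * ‖x‖ ^ 2 + Complex.I * inner ℝ ξ x) := by
    intro x
    rw [gauss, ENNReal.toReal_ofReal (Real.exp_pos _).le, zero_sub, norm_neg, Complex.real_smul,
      Complex.ofReal_exp, ← Complex.exp_add, real_inner_comm]
    congr 1
    push_cast
    ring
  simp_rw [e]
  rw [h]
  refine mul_ne_zero ?_ (Complex.exp_ne_zero _)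
  rw [Ne, Complex.cpow_eq_zero_iff]
  have h1 : (Real.pi : ℂ) ≠ 0 := by exact_mod_cast Real.pi_pos.ne'
  have h2 : ((2 * s : ℝ) : ℂ) ≠ 0 := by exact_mod_cast (by positivity : 2 * s ≠ 0)
  simp [h1, hs.ne']

lemma conv_gaussMeasure (σ : Measure ℂ) [IsFiniteMeasure σ] {s : ℝ} (hs : 0 < s) :
    σ.conv (gaussMeasure s) = volume.withDensity (fun x => gaussAvg σ (s, x)) := by
  have := isFiniteMeasure_gaussMeasure hs
  have hm : Measurable (fun x : ℂ => gauss s x 0) := by unfold gauss; fun_prop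
  have hm2 : Measurable (fun q : ℂ × ℂ => gauss s q.2 q.1) := by unfold gauss; fun_prop
  ext A hA
  rw [← lintegral_indicator_one hA, Measure.lintegral_conv (measurable_one.indicator hA),
    withDensity_apply _ hA, ← lintegral_indicator hA]
  have e : ∀ z : ℂ, ∫⁻ y, A.indicator 1 (z + y) ∂(gaussMeasure s) =
      ∫⁻ x, A.indicator (fun x => gauss s x z) x := by
    intro z
    rw [gaussMeasure, lintegral_withDensity_eq_lintegral_mul _ hm
      (g := fun y => A.indicator (1 : ℂ → ℝ≥0∞) (z + y))
      ((measurable_one.indicator hA).comp (measurable_const_add z)),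
      ← lintegral_add_left_eq_self (fun x => A.indicator (fun x => gauss s x z) x) z]
    refine lintegral_congr fun y => ?_
    by_cases h : z + y ∈ A
    · simp [h, gauss]
    · simp [h]
  simp_rw [e]
  rw [lintegral_lintegral_swap]
  · refine lintegral_congr fun x => ?_
    by_cases h : x ∈ A
    · simp [h, gaussAvg]
    · simp [h]
  · refine Measurable.aemeasurable ?_
    have : (Function.uncurry fun z x : ℂ => A.indicator (fun x => gauss s x z) x) =
        (Prod.snd ⁻¹' A).indicator (fun q : ℂ × ℂ => gauss s q.2 q.1) := by
      ext q
      by_cases h : q.2 ∈ A <;> simp [Function.uncurry, h]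
    rw [this]
    exact hm2.indicator (measurable_snd hA)

/-- The characteristic function of a Gaussian has no zeros, so it can be divided out of that of the
convolution. -/
lemma eq_of_gaussGap_eq_zero {a b : ℝ} (hab : a < b) (μ ν : Measure ℂ)
    [IsFiniteMeasure μ] [IsFiniteMeasure ν] (h : gaussGap a b μ ν = 0) : μ = ν := by
  obtain ⟨s, hs, hae⟩ := gaussAvg_ae_eq_of_gaussGap_eq_zero hab μ ν h
  have := isFiniteMeasure_gaussMeasure hs
  have hc : μ.conv (gaussMeasure s) = ν.conv (gaussMeasure s) := by
    rw [conv_gaussMeasure μ hs, conv_gaussMeasure ν hs]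
    exact withDensity_congr_ae hae
  refine Measure.ext_of_charFun (funext fun ξ => ?_)
  have h1 := charFun_conv (μ := μ) (ν := gaussMeasure s) ξ
  rw [hc, charFun_conv] at h1
  exact (mul_right_cancel₀ (charFun_gaussMeasure_ne_zero hs ξ) h1).symm

/-! ### The spherical kernel and its bounded approximations -/

/-- Half the logarithm of `1 + |z|²`. -/
noncomputable def weight (z : ℂ) : ℝ := Real.log (1 + ‖z‖ ^ 2) / 2

/-- The nonnegative kernel `log (1 / |z - w|) + weight z + weight w`, that is, the logarithmic
kernel of the Riemann sphere. -/
noncomputable def sphericalKernel (z w : ℂ) : ℝ≥0∞ :=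
  if z = w then ⊤ else ENNReal.ofReal (weight z + weight w - Real.log ‖z - w‖)

/-- The logarithm truncated at `1 / (n + 2)` and `n + 2`, with a minus sign. -/
noncomputable def truncLog (n : ℕ) (x : ℝ) : ℝ :=
  Real.log ((x + ((n : ℝ) + 2)) / (x + 1 / ((n : ℝ) + 2)))

/-- Bounded approximation of the spherical kernel. -/
noncomputable def truncKernel (n : ℕ) (z w : ℂ) : ℝ :=
  (truncLog n (‖z - w‖ ^ 2) - truncLog n (1 + ‖z‖ ^ 2) - truncLog n (1 + ‖w‖ ^ 2)
    + truncLog n 1) / 2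

lemma measurable_sphericalKernel : Measurable (fun p : ℂ × ℂ => sphericalKernel p.1 p.2) := by
  unfold sphericalKernel weight
  refine Measurable.ite (measurableSet_eq_fun measurable_fst measurable_snd) measurable_const ?_
  fun_prop

lemma measurable_truncLog (n : ℕ) : Measurable (truncLog n) := by
  unfold truncLog; fun_prop

lemma measurable_truncKernel (n : ℕ) : Measurable (fun p : ℂ × ℂ => truncKernel n p.1 p.2) := by
  unfold truncKernel truncLog; fun_prop

lemma truncKernel_comm (n : ℕ) (z w : ℂ) : truncKernel n z w = truncKernel n w z := by
  unfold truncKernel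
  rw [norm_sub_rev]
  ring

lemma weight_nonneg (z : ℂ) : 0 ≤ weight z :=
  div_nonneg (Real.log_nonneg (by nlinarith [sq_nonneg ‖z‖])) (by norm_num)

/-- `(1 + |z|²)(1 + |w|²) - (|z| + |w|)² = (|z| |w| - 1)²`. -/
lemma norm_sub_sq_le_mul (z w : ℂ) : ‖z - w‖ ^ 2 ≤ (1 + ‖z‖ ^ 2) * (1 + ‖w‖ ^ 2) := by
  have h1 := norm_sub_le z w
  have h3 := norm_nonneg (z - w)
  nlinarith [sq_nonneg (‖z‖ * ‖w‖ - 1)]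

lemma weight_add_weight_sub_log_nonneg {z w : ℂ} (h : z ≠ w) :
    0 ≤ weight z + weight w - Real.log ‖z - w‖ := by
  have hr : 0 < ‖z - w‖ := norm_pos_iff.2 (sub_ne_zero.2 h)
  have hl : Real.log (‖z - w‖ ^ 2) = 2 * Real.log ‖z - w‖ := by rw [Real.log_pow]; norm_num
  have := Real.log_le_log (by positivity) (norm_sub_sq_le_mul z w)
  rw [Real.log_mul (by positivity) (by positivity), hl] at this
  unfold weight
  linarith

lemma one_div_add_two_le (n : ℕ) : 1 / ((n : ℝ) + 2) ≤ (n : ℝ) + 2 := by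
  have : (0 : ℝ) ≤ n := n.cast_nonneg
  rw [div_le_iff₀ (by positivity)]
  nlinarith

lemma truncLog_eq (n : ℕ) {x : ℝ} (hx : 0 ≤ x) :
    truncLog n x = Real.log (x + ((n : ℝ) + 2)) - Real.log (x + 1 / ((n : ℝ) + 2)) :=
  Real.log_div (by positivity) (by positivity)

lemma truncLog_nonneg (n : ℕ) {x : ℝ} (hx : 0 ≤ x) : 0 ≤ truncLog n x := by
  apply Real.log_nonneg
  rw [one_le_div (by positivity)]
  have := one_div_add_two_le n
  linarith

lemma truncLog_anti (n : ℕ) {x y : ℝ} (hx : 0 ≤ x) (hxy : x ≤ y) :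
    truncLog n y ≤ truncLog n x := by
  have hy := hx.trans hxy
  apply Real.log_le_log (by positivity)
  rw [div_le_div_iff₀ (by positivity) (by positivity)]
  have := one_div_add_two_le n
  nlinarith

lemma truncLog_sub_le (n : ℕ) {x y : ℝ} (hx : 0 < x) (hxy : x ≤ y) :
    truncLog n x - truncLog n y ≤ Real.log y - Real.log x := by
  have hy := hx.trans_le hxy
  rw [truncLog_eq n hx.le, truncLog_eq n hy.le]
  have h1 : Real.log (x + ((n : ℝ) + 2)) ≤ Real.log (y + ((n : ℝ) + 2)) :=
    Real.log_le_log (by positivity) (by linarith)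
  have h2 : Real.log ((y + 1 / ((n : ℝ) + 2)) * x) ≤ Real.log (y * (x + 1 / ((n : ℝ) + 2))) := by
    apply Real.log_le_log (by positivity)
    have : 0 ≤ 1 / ((n : ℝ) + 2) := by positivity
    nlinarith
  rw [Real.log_mul (by positivity) (by positivity),
    Real.log_mul (by positivity) (by positivity)] at h2
  linarith

lemma log_four : Real.log 4 = 2 * Real.log 2 := by
  rw [show (4 : ℝ) = 2 ^ 2 by norm_num, Real.log_pow]; norm_num

lemma norm_sub_sq_le {z w : ℂ} (h : ‖w‖ ≤ ‖z‖) : ‖z - w‖ ^ 2 ≤ 4 * (1 + ‖z‖ ^ 2) := by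
  have h1 := norm_sub_le z w
  have h2 : ‖z - w‖ ≤ 2 * ‖z‖ := by linarith
  have h3 := norm_nonneg (z - w)
  nlinarith

/-- When `|w| ≤ |z|`, the bound `|z - w|² ≤ 4 (1 + |z|²)` costs at most `log 4` between the first
two terms, and the other two have a nonnegative sum; the kernel halves the result. -/
lemma neg_log_two_le_truncKernel (n : ℕ) (z w : ℂ) : -Real.log 2 ≤ truncKernel n z w := by
  wlog h : ‖w‖ ≤ ‖z‖ generalizing z w
  · rw [truncKernel_comm]
    exact this w z (le_of_not_ge h)
  have h1 := truncLog_anti n (by positivity) (norm_sub_sq_le h)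
  have h2 := truncLog_sub_le n (x := 1 + ‖z‖ ^ 2) (y := 4 * (1 + ‖z‖ ^ 2)) (by positivity)
    (by nlinarith [sq_nonneg ‖z‖])
  have h3 := truncLog_anti n (x := 1) (y := 1 + ‖w‖ ^ 2) (by norm_num)
    (by nlinarith [sq_nonneg ‖w‖])
  rw [Real.log_mul (by norm_num) (by positivity), log_four] at h2
  unfold truncKernel
  linarith

lemma truncKernel_le (n : ℕ) {z w : ℂ} (hzw : z ≠ w) :
    truncKernel n z w ≤ weight z + weight w - Real.log ‖z - w‖ + Real.log 2 := by
  wlog h : ‖w‖ ≤ ‖z‖ generalizing z w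
  · rw [truncKernel_comm, norm_sub_rev, add_comm (weight z)]
    exact this hzw.symm (le_of_not_ge h)
  have hr : 0 < ‖z - w‖ := norm_pos_iff.2 (sub_ne_zero.2 hzw)
  have hl : Real.log (‖z - w‖ ^ 2) = 2 * Real.log ‖z - w‖ := by rw [Real.log_pow]; norm_num
  have h2 : Real.log (‖z - w‖ ^ 2) ≤ _ := Real.log_le_log (by positivity) (norm_sub_sq_le h)
  rw [Real.log_mul (by norm_num) (by positivity), log_four] at h2
  have h3 := truncLog_sub_le n (x := 1) (y := 1 + ‖w‖ ^ 2) (by norm_num)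
    (by nlinarith [sq_nonneg ‖w‖])
  rw [Real.log_one] at h3
  have h4 : 0 ≤ Real.log 2 := Real.log_nonneg (by norm_num)
  unfold truncKernel weight
  -- In the first case the truncation only shrinks differences of logarithms. In the second the
  -- kernel is at most `weight w`, and `log 2` makes up for `weight z - log |z - w|`, which may be
  -- negative.
  rcases le_total (‖z - w‖ ^ 2) (1 + ‖z‖ ^ 2) with h1 | h1
  · have := truncLog_sub_le n (by positivity) h1
    linarith
  · have := truncLog_anti n (by positivity) h1
    linarith

lemma tendsto_add_two : Tendsto (fun n : ℕ => (n : ℝ) + 2) atTop atTop :=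
  tendsto_atTop_add_const_right _ _ tendsto_natCast_atTop_atTop

lemma tendsto_log_add_sub_log (x : ℝ) :
    Tendsto (fun n : ℕ => Real.log (x + ((n : ℝ) + 2)) - Real.log ((n : ℝ) + 2)) atTop (𝓝 0) := by
  have h := (Real.tendsto_log_comp_add_sub_log x).comp tendsto_add_two
  refine h.congr fun n => ?_
  simp [add_comm]

lemma tendsto_log_add_one_div {x : ℝ} (hx : 0 < x) :
    Tendsto (fun n : ℕ => Real.log (x + 1 / ((n : ℝ) + 2))) atTop (𝓝 (Real.log x)) := by
  have h : Tendsto (fun n : ℕ => x + 1 / ((n : ℝ) + 2)) atTop (𝓝 (x + 0)) := by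
    refine tendsto_const_nhds.add ?_
    simp only [one_div]
    exact tendsto_inv_atTop_zero.comp tendsto_add_two
  rw [add_zero] at h
  exact h.log hx.ne'

lemma tendsto_truncLog_sub_log {x : ℝ} (hx : 0 < x) :
    Tendsto (fun n : ℕ => truncLog n x - Real.log ((n : ℝ) + 2)) atTop (𝓝 (-Real.log x)) := by
  have := (tendsto_log_add_sub_log x).sub (tendsto_log_add_one_div hx)
  rw [zero_sub] at this
  refine this.congr fun n => ?_
  rw [truncLog_eq n hx.le]
  ring

/-- Each `truncLog n` diverges like `log (n + 2)`, but the four coefficients `1, -1, -1, 1` sum to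
zero; this is why `truncLog n 1` is part of the kernel. -/
lemma tendsto_truncKernel {z w : ℂ} (hzw : z ≠ w) :
    Tendsto (fun n => truncKernel n z w) atTop (𝓝 (weight z + weight w - Real.log ‖z - w‖)) := by
  have hr : 0 < ‖z - w‖ := norm_pos_iff.2 (sub_ne_zero.2 hzw)
  have hl : Real.log (‖z - w‖ ^ 2) = 2 * Real.log ‖z - w‖ := by rw [Real.log_pow]; norm_num
  have h1 := tendsto_truncLog_sub_log (x := ‖z - w‖ ^ 2) (by positivity)
  have h2 := tendsto_truncLog_sub_log (x := 1 + ‖z‖ ^ 2) (by positivity)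
  have h3 := tendsto_truncLog_sub_log (x := 1 + ‖w‖ ^ 2) (by positivity)
  have h4 := tendsto_truncLog_sub_log (x := 1) (by positivity)
  have h := (((h1.sub h2).sub h3).add h4).div_const 2
  refine (h.congr fun n => ?_).trans (le_of_eq ?_)
  · unfold truncKernel; ring
  · congr 1
    rw [hl, Real.log_one, weight, weight]
    ring

lemma tendsto_truncKernel_self (z : ℂ) : Tendsto (fun n => truncKernel n z z) atTop atTop := by
  have h2 := tendsto_truncLog_sub_log (x := 1 + ‖z‖ ^ 2) (by positivity)
  have h4 := tendsto_truncLog_sub_log (x := 1) (by positivity)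
  have h := (((h4.sub h2).sub h2).add_atTop
    (Real.tendsto_log_atTop.comp tendsto_add_two)).atTop_div_const (r := 2) (by norm_num)
  refine h.congr fun n => ?_
  have h0 : truncLog n 0 = 2 * Real.log ((n : ℝ) + 2) := by
    rw [truncLog_eq n le_rfl, zero_add, zero_add, one_div, Real.log_inv]
    ring
  simp only [truncKernel, sub_self, norm_zero, Function.comp_apply]
  rw [zero_pow two_ne_zero, h0]
  ring

lemma tendsto_ofReal_truncKernel (z w : ℂ) :
    Tendsto (fun n => ENNReal.ofReal (truncKernel n z w + Real.log 2)) atTop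
      (𝓝 (sphericalKernel z w + ENNReal.ofReal (Real.log 2))) := by
  have h4 : 0 ≤ Real.log 2 := Real.log_nonneg (by norm_num)
  unfold sphericalKernel
  split_ifs with h
  · subst h
    rw [top_add]
    exact ENNReal.tendsto_ofReal_atTop.comp
      (tendsto_atTop_add_const_right _ _ (tendsto_truncKernel_self z))
  · have hpos : 0 ≤ weight z + weight w - Real.log ‖z - w‖ := weight_add_weight_sub_log_nonneg h
    rw [← ENNReal.ofReal_add hpos h4]
    exact ENNReal.tendsto_ofReal ((tendsto_truncKernel h).add_const _)

lemma ofReal_truncKernel_le (n : ℕ) (z w : ℂ) :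
    ENNReal.ofReal (truncKernel n z w + Real.log 2) ≤
      sphericalKernel z w + ENNReal.ofReal (2 * Real.log 2) := by
  unfold sphericalKernel
  split_ifs with h
  · simp
  · rw [← ENNReal.ofReal_add (weight_add_weight_sub_log_nonneg h)
      (by have := Real.log_nonneg (x := 2) (by norm_num); positivity)]
    exact ENNReal.ofReal_le_ofReal (by linarith [truncKernel_le n h])

/-! ### The energy inequality -/

/-- The mutual energy of two measures for the spherical kernel. -/
noncomputable def mutualEnergy (σ τ : Measure ℂ) : ℝ≥0∞ :=
  ∫⁻ p, sphericalKernel p.1 p.2 ∂(σ.prod τ)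

/-- The mutual energy of two measures for the truncated kernel, raised by `log 2`. -/
noncomputable def truncEnergy (n : ℕ) (σ τ : Measure ℂ) : ℝ≥0∞ :=
  ∫⁻ p, ENNReal.ofReal (truncKernel n p.1 p.2 + Real.log 2) ∂(σ.prod τ)

lemma lintegral_raised_sphericalKernel (σ τ : Measure ℂ) :
    ∫⁻ p, (sphericalKernel p.1 p.2 + ENNReal.ofReal (Real.log 2)) ∂(σ.prod τ) =
      mutualEnergy σ τ + ENNReal.ofReal (Real.log 2) * (σ.prod τ) Set.univ := by
  rw [lintegral_add_right _ measurable_const, lintegral_const, mutualEnergy]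

lemma tendsto_truncEnergy (σ τ : Measure ℂ) [IsFiniteMeasure σ] [IsFiniteMeasure τ]
    (h : mutualEnergy σ τ ≠ ⊤) :
    Tendsto (fun n => truncEnergy n σ τ) atTop
      (𝓝 (mutualEnergy σ τ + ENNReal.ofReal (Real.log 2) * (σ.prod τ) Set.univ)) := by
  rw [← lintegral_raised_sphericalKernel]
  refine tendsto_lintegral_of_dominated_convergence
    (fun p => sphericalKernel p.1 p.2 + ENNReal.ofReal (2 * Real.log 2)) ?_ ?_ ?_ ?_
  · intro n
    exact ((measurable_truncKernel n).add_const _).ennreal_ofReal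
  · exact fun n => Eventually.of_forall fun p => ofReal_truncKernel_le n p.1 p.2
  · rw [lintegral_add_right _ measurable_const, lintegral_const]
    exact ENNReal.add_ne_top.2 ⟨h, ENNReal.mul_ne_top ENNReal.ofReal_ne_top (measure_ne_top _ _)⟩
  · exact Eventually.of_forall fun p => tendsto_ofReal_truncKernel p.1 p.2

/-- Fatou's lemma suffices for the mixed term, whose finiteness is not known beforehand. -/
lemma le_liminf_truncEnergy (σ τ : Measure ℂ) :
    2 * (mutualEnergy σ τ + ENNReal.ofReal (Real.log 2) * (σ.prod τ) Set.univ) ≤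
      liminf (fun n => 2 * truncEnergy n σ τ) atTop := by
  have hm : ∀ n, Measurable (fun p : ℂ × ℂ => ENNReal.ofReal (truncKernel n p.1 p.2 + Real.log 2)) :=
    fun n => ((measurable_truncKernel n).add_const _).ennreal_ofReal
  rw [← lintegral_raised_sphericalKernel, ← lintegral_const_mul _
    (measurable_sphericalKernel.add_const _)]
  simp_rw [truncEnergy, ← lintegral_const_mul _ (hm _)]
  refine le_trans (le_of_eq (lintegral_congr fun p => ?_)) (lintegral_liminf_le fun n =>
    (hm n).const_mul 2)
  exact (ENNReal.Tendsto.const_mul (tendsto_ofReal_truncKernel p.1 p.2)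
    (Or.inr (by norm_num))).liminf_eq.symm

/-- The potential term of the truncated kernel. -/
noncomputable def truncMoment (n : ℕ) (σ : Measure ℂ) : ℝ≥0∞ :=
  ∫⁻ z, ENNReal.ofReal (truncLog n (1 + ‖z‖ ^ 2) / 2) ∂σ

lemma truncMoment_ne_top (n : ℕ) (σ : Measure ℂ) [IsFiniteMeasure σ] : truncMoment n σ ≠ ⊤ := by
  refine ne_of_lt ((lintegral_mono (g := fun _ => ENNReal.ofReal (truncLog n 0 / 2))
    fun z => ?_).trans_lt ?_)
  · have := truncLog_anti n (x := 0) (y := 1 + ‖z‖ ^ 2) le_rfl (by positivity)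
    exact ENNReal.ofReal_le_ofReal (by linarith)
  · rw [lintegral_const]
    exact ENNReal.mul_lt_top ENNReal.ofReal_lt_top (measure_lt_top _ _)

/-- Isolates the two-variable part of the kernel, to which the Gaussian identity applies, from the
terms in one variable. -/
lemma truncEnergy_add_eq (n : ℕ) (σ τ : Measure ℂ) [IsFiniteMeasure σ] [IsFiniteMeasure τ] :
    truncEnergy n σ τ + (truncMoment n σ * τ Set.univ + truncMoment n τ * σ Set.univ) =
      ENNReal.ofReal (1 / 2) * (∫⁻ z, ∫⁻ w, ENNReal.ofReal (truncLog n (‖z - w‖ ^ 2)) ∂τ ∂σ) +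
        ENNReal.ofReal (truncLog n 1 / 2 + Real.log 2) * (σ Set.univ * τ Set.univ) := by
  have hL := measurable_truncLog n
  have hK := measurable_truncKernel n
  have e1 : truncMoment n σ * τ Set.univ =
      ∫⁻ p, ENNReal.ofReal (truncLog n (1 + ‖p.1‖ ^ 2) / 2) ∂(σ.prod τ) := by
    rw [lintegral_prod _ (by fun_prop)]
    simp only [lintegral_const]
    rw [lintegral_mul_const _ (by fun_prop), truncMoment]
  have e2 : truncMoment n τ * σ Set.univ =
      ∫⁻ p, ENNReal.ofReal (truncLog n (1 + ‖p.2‖ ^ 2) / 2) ∂(σ.prod τ) := by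
    rw [lintegral_prod _ (by fun_prop)]
    simp only [lintegral_const]
    rw [truncMoment]
  have e3 : ∫⁻ z, ∫⁻ w, ENNReal.ofReal (truncLog n (‖z - w‖ ^ 2)) ∂τ ∂σ =
      ∫⁻ p, ENNReal.ofReal (truncLog n (‖p.1 - p.2‖ ^ 2)) ∂(σ.prod τ) := by
    rw [lintegral_prod _ (by fun_prop)]
  have e4 : ENNReal.ofReal (truncLog n 1 / 2 + Real.log 2) * (σ Set.univ * τ Set.univ) =
      ∫⁻ _p, ENNReal.ofReal (truncLog n 1 / 2 + Real.log 2) ∂(σ.prod τ) := by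
    rw [lintegral_const, ← Set.univ_prod_univ, Measure.prod_prod]
  rw [e1, e2, e3, e4, truncEnergy, ← lintegral_const_mul _ (by fun_prop),
    ← lintegral_add_left (by fun_prop), ← lintegral_add_left (by fun_prop),
    ← lintegral_add_left (by fun_prop)]
  refine lintegral_congr fun p => ?_
  have h0 := neg_log_two_le_truncKernel n p.1 p.2
  have h1 := truncLog_nonneg n (x := 1 + ‖p.1‖ ^ 2) (by positivity)
  have h2 := truncLog_nonneg n (x := 1 + ‖p.2‖ ^ 2) (by positivity)
  have h3 := truncLog_nonneg n (x := ‖p.1 - p.2‖ ^ 2) (by positivity)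
  have h4 := truncLog_nonneg n (x := 1) (by positivity)
  have h5 : 0 ≤ Real.log 2 := Real.log_nonneg (by norm_num)
  rw [← ENNReal.ofReal_mul (by norm_num), ← ENNReal.ofReal_add (by positivity) (by positivity),
    ← ENNReal.ofReal_add (by linarith) (by positivity),
    ← ENNReal.ofReal_add (by positivity) (by positivity)]
  congr 1
  unfold truncKernel
  ring

/-- Equal masses make the one-variable and constant terms the same on both sides; the moments are
finite, hence can be cancelled. -/
lemma truncEnergy_gap (n : ℕ) (μ ν : Measure ℂ) [IsFiniteMeasure μ] [IsFiniteMeasure ν]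
    (hm : μ Set.univ = ν Set.univ) :
    2 * truncEnergy n μ ν +
        ENNReal.ofReal (1 / 2) * gaussGap (1 / ((n : ℝ) + 2)) ((n : ℝ) + 2) μ ν =
      truncEnergy n μ μ + truncEnergy n ν ν := by
  have hg := energy_add_energy_eq (a := 1 / ((n : ℝ) + 2)) (b := (n : ℝ) + 2) (by positivity)
    (one_div_add_two_le n) μ ν
  have h1 := truncEnergy_add_eq n μ μ
  have h2 := truncEnergy_add_eq n ν ν
  have h3 := truncEnergy_add_eq n μ ν
  rw [← hm] at h2 h3
  simp only [truncLog] at h1 h2 h3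
  have fin : 2 * (truncMoment n μ * μ Set.univ + truncMoment n ν * μ Set.univ) ≠ ⊤ :=
    ENNReal.mul_ne_top (by norm_num) (ENNReal.add_ne_top.2
      ⟨ENNReal.mul_ne_top (truncMoment_ne_top n μ) (measure_ne_top _ _),
        ENNReal.mul_ne_top (truncMoment_ne_top n ν) (measure_ne_top _ _)⟩)
  refine (ENNReal.add_left_inj fin).1 ?_
  generalize ENNReal.ofReal (1 / 2) = r at *
  calc _ = 2 * (truncEnergy n μ ν + (truncMoment n μ * μ Set.univ + truncMoment n ν * μ Set.univ))
          + r * gaussGap (1 / ((n : ℝ) + 2)) ((n : ℝ) + 2) μ ν := by ring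
    _ = _ := by
      rw [h3, mul_add, mul_left_comm, add_right_comm, ← mul_add, ← hg]
    _ = _ := by rw [mul_add, two_mul (_ * _), add_add_add_comm, ← h1, ← h2]
    _ = _ := by ring

/-- The energy inequality for measures of equal mass, with the Gaussian energy of their difference
as remainder. -/
theorem two_mul_mutualEnergy_add_le (μ ν : Measure ℂ) [IsFiniteMeasure μ] [IsFiniteMeasure ν]
    (hm : μ Set.univ = ν Set.univ) (hμ : mutualEnergy μ μ ≠ ⊤) (hν : mutualEnergy ν ν ≠ ⊤) :
    2 * mutualEnergy μ ν + ENNReal.ofReal (1 / 2) * gaussGap (1 / 2) 2 μ ν ≤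
      mutualEnergy μ μ + mutualEnergy ν ν := by
  set d := ENNReal.ofReal (1 / 2) * gaussGap (1 / 2) 2 μ ν
  set c := ENNReal.ofReal (Real.log 2) * (μ Set.univ * μ Set.univ) with hc
  have hle : ∀ n, 2 * truncEnergy n μ ν + d ≤ truncEnergy n μ μ + truncEnergy n ν ν := by
    intro n
    rw [← truncEnergy_gap n μ ν hm]
    have hn : (0 : ℝ) ≤ n := n.cast_nonneg
    -- The interval `(1 / 2, 2]` belongs to `n = 0` and lies in all the later ones, so the remainder
    -- is independent of `n`.
    refine add_le_add le_rfl (mul_le_mul_right (gaussGap_mono ?_ (by linarith) μ ν) _)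
    exact one_div_le_one_div_of_le (by norm_num) (by linarith)
  have hlim := (tendsto_truncEnergy μ μ hμ).add (tendsto_truncEnergy ν ν hν)
  have hf := le_liminf_truncEnergy μ ν
  have hprod : ∀ σ τ : Measure ℂ, ∀ [IsFiniteMeasure σ] [IsFiniteMeasure τ],
      (σ.prod τ) Set.univ = σ Set.univ * τ Set.univ := by
    intro σ τ _ _
    rw [← Set.univ_prod_univ, Measure.prod_prod]
  simp only [hprod, ← hm, ← hc] at hlim hf
  have h1 : 2 * (mutualEnergy μ ν + c) + d ≤
      mutualEnergy μ μ + c + (mutualEnergy ν ν + c) := by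
    rw [← hlim.liminf_eq]
    refine (add_le_add_left hf d).trans ?_
    rw [← liminf_add_const atTop _ d (by isBoundedDefault) (by isBoundedDefault)]
    exact liminf_le_liminf (Eventually.of_forall hle)
  have hcf : 2 * c ≠ ⊤ := by finiteness
  refine (ENNReal.add_le_add_iff_right hcf).1 ?_
  convert h1 using 1 <;> ring

/-! ### Integrals of extended-real functions -/

lemma toENNReal_neg_le {f : EReal} {g G : ℝ≥0∞} (h : f + g = G) : (-f).toENNReal ≤ g := by
  refine EReal.toENNReal_le_toENNReal (y := (g : EReal)) ?_ |>.trans_eq EReal.toENNReal_coe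
  rw [EReal.neg_le]
  have h0 : (0 : EReal) ≤ f + g := h ▸ EReal.coe_ennreal_nonneg G
  induction f with
  | bot => simp at h0
  | top => simp
  | coe r =>
    induction g using ENNReal.recTopCoe with
    | top => simp
    | coe a =>
      have h1 : ((a : ℝ≥0∞) : EReal) = ((a : ℝ) : EReal) := rfl
      rw [h1] at h0 ⊢
      norm_cast at h0 ⊢
      linarith

lemma add_toENNReal_neg {f : EReal} {g G : ℝ≥0∞} (h : f + g = G) (hg : g ≠ ⊤) :
    G + (-f).toENNReal = f.toENNReal + g := by
  lift g to NNReal using hg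
  have h1 : ((g : ℝ≥0∞) : EReal) = ((g : ℝ) : EReal) := rfl
  rw [h1] at h
  have hG : G = (f + ((g : ℝ) : EReal)).toENNReal := by rw [h, EReal.toENNReal_coe]
  have h0 : (0 : EReal) ≤ f + ((g : ℝ) : EReal) := h ▸ EReal.coe_ennreal_nonneg G
  have hg' : (g : ℝ≥0∞) = ENNReal.ofReal (g : ℝ) := by simp
  rw [hG, hg']
  induction f with
  | bot => simp at h0
  | top => simp
  | coe r =>
    rw [← EReal.coe_neg, ← EReal.coe_add]
    simp only [EReal.real_coe_toENNReal]
    have h2 : 0 ≤ r + (g : ℝ) := by exact_mod_cast h0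
    rcases le_total 0 r with hr | hr
    · rw [ENNReal.ofReal_of_nonpos (by linarith : -r ≤ 0), add_zero,
        ENNReal.ofReal_add hr g.coe_nonneg]
    · rw [ENNReal.ofReal_of_nonpos hr, zero_add, ← ENNReal.ofReal_add h2 (by linarith)]
      congr 1
      ring

/-- The integral of a function that becomes nonnegative after adding an integrable function. -/
lemma eintegral_eq_sub {α : Type*} [MeasurableSpace α] {σ : Measure α} {f : α → EReal}
    {g G : α → ℝ≥0∞} (hg : AEMeasurable g σ) (hG : AEMeasurable G σ)
    (hgi : ∫⁻ x, g x ∂σ ≠ ⊤) (h : ∀ᵐ x ∂σ, f x + g x = G x) :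
    eintegral σ f = ((∫⁻ x, G x ∂σ : ℝ≥0∞) : EReal) - ((∫⁻ x, g x ∂σ : ℝ≥0∞) : EReal) := by
  have hN : ∫⁻ x, (-f x).toENNReal ∂σ ≤ ∫⁻ x, g x ∂σ :=
    lintegral_mono_ae (h.mono fun x hx => toENNReal_neg_le hx)
  have hsum : (∫⁻ x, G x ∂σ) + ∫⁻ x, (-f x).toENNReal ∂σ =
      (∫⁻ x, (f x).toENNReal ∂σ) + ∫⁻ x, g x ∂σ := by
    rw [← lintegral_add_left' hG, ← lintegral_add_right' _ hg]
    refine lintegral_congr_ae ?_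
    filter_upwards [h, ae_lt_top' hg hgi] with x hx hx2
    exact add_toENNReal_neg hx hx2.ne
  unfold eintegral
  have hN' := ne_top_of_le_ne_top hgi hN
  generalize ∫⁻ x, G x ∂σ = X at *
  generalize ∫⁻ x, g x ∂σ = c at *
  generalize ∫⁻ x, (-f x).toENNReal ∂σ = N at *
  generalize ∫⁻ x, (f x).toENNReal ∂σ = Y at *
  lift c to NNReal using hgi
  lift N to NNReal using hN'
  have e : ∀ a : NNReal, ((a : ℝ≥0∞) : EReal) = ((a : ℝ) : EReal) := fun _ => rfl
  induction X using ENNReal.recTopCoe with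
  | top =>
    have : Y = ⊤ := by
      rw [top_add] at hsum
      by_contra hY
      exact ENNReal.add_ne_top.2 ⟨hY, ENNReal.coe_ne_top⟩ hsum.symm
    rw [this, e, e, EReal.coe_ennreal_top, EReal.top_sub_coe, EReal.top_sub_coe]
  | coe X =>
    have hY : Y ≠ ⊤ := by
      rintro rfl
      rw [top_add] at hsum
      exact ENNReal.add_ne_top.2 ⟨ENNReal.coe_ne_top, ENNReal.coe_ne_top⟩ hsum
    lift Y to NNReal using hY
    rw [e, e, e, e]
    have h1 : (X : ℝ) + N = Y + c := by exact_mod_cast hsum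
    rw [← EReal.coe_sub, ← EReal.coe_sub]
    congr 1
    linarith

/-! ### Potentials, finite energy and capacity -/

lemma coe_ofReal_of_nonneg {r : ℝ} (hr : 0 ≤ r) : ((ENNReal.ofReal r : ℝ≥0∞) : EReal) = r := by
  rw [EReal.coe_ennreal_ofReal, max_eq_left hr]

lemma logKernel_self (z : ℂ) : logKernel z z = ⊤ := by
  simp [logKernel]

lemma logKernel_of_ne {z w : ℂ} (h : z ≠ w) : logKernel z w = ((-Real.log ‖z - w‖ : ℝ) : EReal) := by
  rw [logKernel, ← ofReal_norm,
    ENNReal.log_ofReal_of_pos (norm_pos_iff.2 (sub_ne_zero.2 h)), EReal.coe_neg]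

lemma logKernel_add_weight (z w : ℂ) :
    logKernel z w + ((ENNReal.ofReal (weight z) + ENNReal.ofReal (weight w) : ℝ≥0∞) : EReal) =
      sphericalKernel z w := by
  rw [← ENNReal.ofReal_add (weight_nonneg z) (weight_nonneg w),
    coe_ofReal_of_nonneg (add_nonneg (weight_nonneg z) (weight_nonneg w)), sphericalKernel]
  split_ifs with h
  · rw [h, logKernel_self, EReal.top_add_coe, EReal.coe_ennreal_top]
  · rw [logKernel_of_ne h, coe_ofReal_of_nonneg (weight_add_weight_sub_log_nonneg h),
      ← EReal.coe_add]
    congr 1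
    ring

lemma toENNReal_logKernel_le (z w : ℂ) : (logKernel z w).toENNReal ≤ sphericalKernel z w := by
  rw [← EReal.toENNReal_coe (x := sphericalKernel z w), ← logKernel_add_weight]
  refine EReal.toENNReal_le_toENNReal ?_
  exact le_add_of_nonneg_right (EReal.coe_ennreal_nonneg _)

lemma sphericalKernel_le (z w : ℂ) : sphericalKernel z w ≤
    (logKernel z w).toENNReal + (ENNReal.ofReal (weight z) + ENNReal.ofReal (weight w)) := by
  rw [← EReal.toENNReal_coe (x := sphericalKernel z w), ← logKernel_add_weight]
  exact EReal.toENNReal_add_le.trans_eq (by rw [EReal.toENNReal_coe])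

lemma measurable_weight : Measurable weight := by unfold weight; fun_prop

/-- The potential of a measure for the spherical kernel. -/
noncomputable def sphericalPotential (σ : Measure ℂ) (z : ℂ) : ℝ≥0∞ :=
  ∫⁻ w, sphericalKernel z w ∂σ

lemma measurable_sphericalPotential (σ : Measure ℂ) [SFinite σ] :
    Measurable (sphericalPotential σ) :=
  measurable_sphericalKernel.lintegral_prod_right'

lemma mutualEnergy_eq_lintegral (σ τ : Measure ℂ) [SFinite σ] [SFinite τ] :
    mutualEnergy σ τ = ∫⁻ z, sphericalPotential τ z ∂σ :=
  lintegral_prod _ measurable_sphericalKernel.aemeasurable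

/-- For fixed `z`, integrability in `w` of the negative part of the kernel controls the logarithmic
moment. The proof uses `1 + |w|² ≤ (1 + |z| + |z - w|)²`. -/
lemma weight_le (z w : ℂ) :
    ENNReal.ofReal (weight w) ≤
      (-logKernel z w).toENNReal + ENNReal.ofReal (Real.log (2 + ‖z‖)) := by
  have hz := norm_nonneg z
  have hlog : 0 ≤ Real.log (2 + ‖z‖) := Real.log_nonneg (by linarith)
  have hw : ‖w‖ ≤ ‖z‖ + ‖z - w‖ := by
    have := norm_sub_le z (z - w)
    simpa using this
  have h1 : weight w ≤ Real.log (1 + ‖z‖ + ‖z - w‖) := by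
    have : Real.log (1 + ‖w‖ ^ 2) ≤ Real.log ((1 + ‖z‖ + ‖z - w‖) ^ 2) := by
      apply Real.log_le_log (by positivity)
      nlinarith [norm_nonneg w, norm_nonneg (z - w)]
    rw [Real.log_pow] at this
    push_cast at this
    unfold weight
    linarith
  rcases le_total ‖z - w‖ 1 with h | h
  · refine le_add_of_nonneg_of_le zero_le (ENNReal.ofReal_le_ofReal (h1.trans ?_))
    exact Real.log_le_log (by positivity) (by linarith)
  · have hne : z ≠ w := by
      rintro rfl
      simp at h
      linarith
    rw [logKernel_of_ne hne, ← EReal.coe_neg, neg_neg, EReal.real_coe_toENNReal,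
      ← ENNReal.ofReal_add (Real.log_nonneg h) hlog]
    refine ENNReal.ofReal_le_ofReal (h1.trans ?_)
    rw [← Real.log_mul (by positivity) (by positivity)]
    exact Real.log_le_log (by positivity) (by nlinarith)

lemma lintegral_ne_top_of_hasFiniteEnergy {μ : Measure ℂ} (h : HasFiniteEnergy μ) :
    ∫⁻ p : ℂ × ℂ, (logKernel p.1 p.2).toENNReal ∂(μ.prod μ) ≠ ⊤ ∧
      ∫⁻ p : ℂ × ℂ, (-logKernel p.1 p.2).toENNReal ∂(μ.prod μ) ≠ ⊤ := by
  obtain ⟨h1, h2⟩ := h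
  unfold logEnergy eintegral at h1 h2
  have hn : ∫⁻ p : ℂ × ℂ, (-logKernel p.1 p.2).toENNReal ∂(μ.prod μ) ≠ ⊤ := by
    intro h
    rw [h] at h1
    simp at h1
  refine ⟨fun h => h2 ?_, hn⟩
  rw [h, EReal.coe_ennreal_top]
  exact EReal.top_sub (by simpa using hn)

lemma measurable_logKernel : Measurable (fun p : ℂ × ℂ => logKernel p.1 p.2) := by
  have : (fun p : ℂ × ℂ => logKernel p.1 p.2) = fun p : ℂ × ℂ =>
      if p.1 = p.2 then ⊤ else ((-Real.log ‖p.1 - p.2‖ : ℝ) : EReal) := by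
    ext p
    split_ifs with h
    · rw [h, logKernel_self]
    · rw [logKernel_of_ne h]
  rw [this]
  refine Measurable.ite (measurableSet_eq_fun measurable_fst measurable_snd) measurable_const ?_
  exact Measurable.coe_real_ereal (by fun_prop)

lemma measurable_toENNReal_neg_logKernel :
    Measurable (fun p : ℂ × ℂ => (-logKernel p.1 p.2).toENNReal) :=
  measurable_logKernel.neg.ereal_toENNReal

/-- Finite energy bounds the double integral of the negative part, so by Tonelli some `z` has a
finite inner integral and `weight_le` applies there. -/
lemma lintegral_weight_ne_top {μ : Measure ℂ} [IsFiniteMeasure μ] (h : HasFiniteEnergy μ) :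
    ∫⁻ w, ENNReal.ofReal (weight w) ∂μ ≠ ⊤ := by
  rcases eq_or_ne μ 0 with rfl | hμ
  · simp
  have hn := (lintegral_ne_top_of_hasFiniteEnergy h).2
  rw [lintegral_prod _ measurable_toENNReal_neg_logKernel.aemeasurable] at hn
  have hae := ae_lt_top (measurable_toENNReal_neg_logKernel.lintegral_prod_right') hn
  have : NeBot (ae μ) := ae_neBot.2 hμ
  obtain ⟨z, hz⟩ := hae.exists
  refine ne_top_of_le_ne_top ?_ (lintegral_mono fun w => weight_le z w)
  rw [lintegral_add_right _ measurable_const, lintegral_const]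
  exact ENNReal.add_ne_top.2 ⟨hz.ne, ENNReal.mul_ne_top ENNReal.ofReal_ne_top (measure_ne_top _ _)⟩

lemma mutualEnergy_self_ne_top {μ : Measure ℂ} [IsFiniteMeasure μ] (h : HasFiniteEnergy μ) :
    mutualEnergy μ μ ≠ ⊤ := by
  have hw := measurable_weight
  have hH := lintegral_weight_ne_top h
  refine ne_top_of_le_ne_top ?_ (lintegral_mono fun p => sphericalKernel_le p.1 p.2)
  rw [lintegral_add_right _ (by fun_prop), lintegral_add_right _ (by fun_prop),
    lintegral_prod (fun p : ℂ × ℂ => ENNReal.ofReal (weight p.1)) (by fun_prop),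
    lintegral_prod (fun p : ℂ × ℂ => ENNReal.ofReal (weight p.2)) (by fun_prop)]
  simp only [lintegral_const]
  rw [lintegral_mul_const _ (by fun_prop)]
  exact ENNReal.add_ne_top.2 ⟨(lintegral_ne_top_of_hasFiniteEnergy h).1, ENNReal.add_ne_top.2
    ⟨ENNReal.mul_ne_top hH (measure_ne_top _ _), ENNReal.mul_ne_top hH (measure_ne_top _ _)⟩⟩

lemma potential_eq_sub {μ : Measure ℂ} [IsFiniteMeasure μ] (h : HasFiniteEnergy μ) (z : ℂ) :
    potential μ z = (sphericalPotential μ z : EReal) -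
      ((ENNReal.ofReal (weight z) * μ Set.univ + ∫⁻ w, ENNReal.ofReal (weight w) ∂μ : ℝ≥0∞) :
        EReal) := by
  have hw := measurable_weight
  have hH := lintegral_weight_ne_top h
  have e : ∫⁻ w, (ENNReal.ofReal (weight z) + ENNReal.ofReal (weight w)) ∂μ =
      ENNReal.ofReal (weight z) * μ Set.univ + ∫⁻ w, ENNReal.ofReal (weight w) ∂μ := by
    rw [lintegral_add_left measurable_const, lintegral_const]
  rw [← e, potential, sphericalPotential]
  refine eintegral_eq_sub (by fun_prop) ?_ ?_ (Eventually.of_forall (logKernel_add_weight z))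
  · exact (measurable_sphericalKernel.comp measurable_prodMk_left).aemeasurable
  · rw [e]
    finiteness

/-- If `A` had positive mass, inner regularity would give a compact `K ⊆ A` of positive mass. The
normalized restriction of `σ` to `K` has energy below `+∞`, so `E` would have positive capacity. -/
lemma measure_eq_zero_of_logCapacity_eq_zero {σ : Measure ℂ} [IsFiniteMeasure σ]
    (hσ : mutualEnergy σ σ ≠ ⊤) {A E : Set ℂ} (hA : MeasurableSet A) (hAE : A ⊆ E)
    (hE : logCapacity E = 0) : σ A = 0 := by
  by_contra hpos
  obtain ⟨K, hKA, hK, hKpos⟩ := hA.exists_lt_isCompact (pos_iff_ne_zero.2 hpos)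
  set c := (σ K)⁻¹
  have hc : c ≠ ⊤ := ENNReal.inv_ne_top.2 hKpos.ne'
  have hprob : IsProbabilityMeasure (c • σ.restrict K) := by
    constructor
    simp only [Measure.smul_apply, Measure.restrict_apply_univ, smul_eq_mul]
    exact ENNReal.inv_mul_cancel hKpos.ne' (measure_ne_top _ _)
  have hcarried : ∃ L : Set ℂ, IsCompact L ∧ L ⊆ E ∧ (c • σ.restrict K) Lᶜ = 0 := by
    refine ⟨K, hK, hKA.trans hAE, ?_⟩
    simp [Measure.restrict_apply hK.measurableSet.compl]
  have hen : logEnergy (c • σ.restrict K) ≠ ⊤ := by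
    have h1 : ∫⁻ p : ℂ × ℂ, (logKernel p.1 p.2).toENNReal
        ∂((c • σ.restrict K).prod (c • σ.restrict K)) ≠ ⊤ := by
      rw [Measure.prod_smul_left, Measure.prod_smul_right, lintegral_smul_measure,
        lintegral_smul_measure, Measure.prod_restrict]
      have h2 : ∫⁻ p in K ×ˢ K, (logKernel p.1 p.2).toENNReal ∂(σ.prod σ) ≠ ⊤ :=
        ne_top_of_le_ne_top hσ ((setLIntegral_le_lintegral _ _).trans
          (lintegral_mono fun p => toENNReal_logKernel_le p.1 p.2))
      simp only [smul_eq_mul]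
      finiteness
    unfold logEnergy eintegral
    intro h
    -- The energy is at most the integral of the positive part of the kernel.
    have h2 := EReal.sub_le_sub (le_refl ((∫⁻ p : ℂ × ℂ, (logKernel p.1 p.2).toENNReal
        ∂((c • σ.restrict K).prod (c • σ.restrict K)) : ℝ≥0∞) : EReal))
        (EReal.coe_ennreal_nonneg (∫⁻ p : ℂ × ℂ, (-logKernel p.1 p.2).toENNReal
        ∂((c • σ.restrict K).prod (c • σ.restrict K))))
    rw [h, sub_zero, top_le_iff, EReal.coe_ennreal_eq_top_iff] at h2
    exact h1 h2
  have hle : EReal.exp (-logEnergy (c • σ.restrict K)) ≤ logCapacity E := by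
    unfold logCapacity
    exact le_iSup₂_of_le (c • σ.restrict K) hprob (le_iSup_of_le hcarried le_rfl)
  rw [hE, le_zero_iff, EReal.exp_eq_zero_iff, EReal.neg_eq_bot_iff] at hle
  exact hen hle

/-! ### The external field -/

/-- Off `S` the values of `Q` are arbitrary; replaced by `⊤` there, `Q` is lower semicontinuous on
the plane because `S` is closed. -/
lemma measurable_piecewise_top {S : Set ℂ} (hS : IsClosed S) {Q : ℂ → EReal}
    (hQ : LowerSemicontinuousOn Q S) [DecidablePred (· ∈ S)] :
    Measurable (S.piecewise Q (fun _ => ⊤)) := by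
  apply LowerSemicontinuous.measurable
  intro z a ha
  by_cases hz : z ∈ S
  · rw [Set.piecewise_eq_of_mem _ _ _ hz] at ha
    have h := eventually_nhdsWithin_iff.1 (hQ z hz a ha)
    filter_upwards [h] with w hw
    by_cases hwS : w ∈ S
    · rw [Set.piecewise_eq_of_mem _ _ _ hwS]
      exact hw hwS
    · rw [Set.piecewise_eq_of_notMem _ _ _ hwS]
      exact ha.trans_le le_top
  · rw [Set.piecewise_eq_of_notMem _ _ _ hz] at ha
    filter_upwards [hS.isOpen_compl.mem_nhds hz] with w hw
    rw [Set.piecewise_eq_of_notMem _ _ _ hw]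
    exact ha

lemma IsWeaklyAdmissible.exists_le {S : Set ℂ} (hS : IsClosed S) {t : ℝ} (ht : 0 < t)
    {Q : ℂ → EReal} (hQ : IsWeaklyAdmissible S t Q) :
    ∃ m : ℝ, 0 ≤ m ∧ ∀ z ∈ S, ((t * (weight z - m) : ℝ) : EReal) ≤ Q z := by
  -- For bounded `S` the filter is trivial, and the bound obtained from `c` is vacuous far out.
  obtain ⟨c, -, hc⟩ := EReal.lt_iff_exists_real_btwn.1 hQ.growth
  have hev := eventually_inf_principal.1 (eventually_lt_of_lt_liminf hc)
  obtain ⟨R, -, hR⟩ := hasBasis_cobounded_norm.eventually_iff.1 hev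
  set R' := max R 1
  have hR1 : 1 ≤ R' := le_max_right _ _
  have hcpt : IsCompact (S ∩ Metric.closedBall 0 R') :=
    (isCompact_closedBall 0 R').inter_left hS
  obtain ⟨b, hb⟩ : ∃ b : ℝ, ∀ z ∈ S ∩ Metric.closedBall 0 R', (b : EReal) ≤ Q z := by
    rcases (S ∩ Metric.closedBall 0 R').eq_empty_or_nonempty with h | h
    · exact ⟨0, by simp [h]⟩
    · obtain ⟨a, ha, hmin⟩ := (hQ.lowerSemicontinuousOn.mono Set.inter_subset_left).exists_isMinOn
        h hcpt
      obtain ⟨b, -, hb⟩ := EReal.lt_iff_exists_real_btwn.1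
        (bot_lt_iff_ne_bot.2 (hQ.ne_bot a ha.1))
      exact ⟨b, fun z hz => hb.le.trans (hmin hz)⟩
  -- `L` bounds `weight` on the ball; as `R' ≥ 1`, also `L ≥ log 2 / 2`, which gives `weight z ≤ log
  -- |z| + L` outside.
  set L := Real.log (1 + R' ^ 2) / 2
  have hL2 : Real.log 2 / 2 ≤ L := by
    have : Real.log 2 ≤ Real.log (1 + R' ^ 2) := Real.log_le_log (by norm_num) (by nlinarith)
    simp only [L]
    linarith
  have hL0 : 0 ≤ L := by
    have := Real.log_nonneg (x := 2) (by norm_num)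
    linarith
  have hm : ∀ x : ℝ, t * (x - (|c| / t + |b| / t + L)) = t * x - |c| - |b| - t * L := by
    intro x
    field_simp
    ring
  refine ⟨|c| / t + |b| / t + L, by positivity, fun z hz => ?_⟩
  rw [hm]
  have hc0 := neg_abs_le c
  have hb0 := neg_abs_le b
  have hc1 := abs_nonneg c
  have hb1 := abs_nonneg b
  rcases le_total ‖z‖ R' with h | h
  · refine le_trans ?_ (hb z ⟨hz, by simpa using h⟩)
    have hw : weight z ≤ L := by
      have : Real.log (1 + ‖z‖ ^ 2) ≤ Real.log (1 + R' ^ 2) :=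
        Real.log_le_log (by positivity) (by nlinarith [norm_nonneg z])
      simp only [L, weight]
      linarith
    have := mul_le_mul_of_nonneg_left hw ht.le
    exact_mod_cast (by linarith : t * weight z - |c| - |b| - t * L ≤ b)
  · have hz1 : 1 ≤ ‖z‖ := hR1.trans h
    have h1 := hR ((le_max_left _ _).trans h) hz
    have h2 : ((c + t * Real.log ‖z‖ : ℝ) : EReal) ≤ Q z := by
      have := EReal.add_le_of_le_sub h1.le
      exact_mod_cast this
    refine le_trans ?_ h2
    have hw : weight z ≤ Real.log ‖z‖ + L := by
      have : Real.log (1 + ‖z‖ ^ 2) ≤ Real.log (2 * ‖z‖ ^ 2) :=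
        Real.log_le_log (by positivity) (by nlinarith)
      rw [Real.log_mul (by norm_num) (by positivity), Real.log_pow] at this
      push_cast at this
      simp only [weight]
      linarith
    have := mul_le_mul_of_nonneg_left hw ht.le
    exact_mod_cast (by linarith : t * weight z - |c| - |b| - t * L ≤ c + t * Real.log ‖z‖)

/-- An admissible field is, up to an additive constant, the sum of the logarithmic weight and of a
nonnegative measurable function. -/
lemma IsWeaklyAdmissible.exists_excess {S : Set ℂ} (hS : IsClosed S) {t : ℝ} (ht : 0 < t)
    {Q : ℂ → EReal} (hQ : IsWeaklyAdmissible S t Q) :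
    ∃ (m : ℝ) (P : ℂ → ℝ≥0∞), 0 ≤ m ∧ Measurable P ∧
      ∀ z ∈ S, Q z / (t : EReal) + (m : EReal) = (weight z : EReal) + (P z : EReal) := by
  classical
  obtain ⟨m, hm, hle⟩ := hQ.exists_le hS ht
  have hQm := measurable_piecewise_top hS hQ.lowerSemicontinuousOn
  refine ⟨m, fun z => if S.piecewise Q (fun _ => ⊤) z = ⊤ then ⊤ else
    ENNReal.ofReal ((S.piecewise Q (fun _ => ⊤) z).toReal / t + m - weight z), hm, ?_, ?_⟩
  · refine Measurable.ite (hQm (measurableSet_singleton ⊤)) measurable_const ?_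
    exact (((hQm.ereal_toReal.div_const t).add_const m).sub measurable_weight).ennreal_ofReal
  · intro z hz
    simp only [Set.piecewise_eq_of_mem _ _ _ hz]
    have hbot := hQ.ne_bot z hz
    have hl := hle z hz
    generalize Q z = q at *
    induction q with
    | bot => exact absurd rfl hbot
    | top =>
      rw [if_pos rfl, EReal.top_div_of_pos_ne_top (by exact_mod_cast ht) (EReal.coe_ne_top t),
        EReal.top_add_coe, EReal.coe_ennreal_top, EReal.coe_add_top]
    | coe r =>
      have hl' : t * (weight z - m) ≤ r := by exact_mod_cast hl
      have h0 : 0 ≤ r / t + m - weight z := by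
        have : weight z - m ≤ r / t := by
          rw [le_div_iff₀ ht]
          linarith
        linarith
      rw [if_neg (EReal.coe_ne_top r), EReal.toReal_coe, coe_ofReal_of_nonneg h0, ← EReal.coe_div,
        ← EReal.coe_add, ← EReal.coe_add]
      congr 1
      ring

lemma add_mul_eq_of_div_add_eq {t : ℝ} (ht : 0 < t) {q : EReal} {m w : ℝ} {p : ℝ≥0∞}
    (h : q / (t : EReal) + (m : EReal) = (w : EReal) + (p : EReal)) :
    q + ((t * m : ℝ) : EReal) = ((t * w : ℝ) : EReal) + ((ENNReal.ofReal t * p : ℝ≥0∞) : EReal) := by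
  have ht' : (0 : EReal) < t := by exact_mod_cast ht
  induction q with
  | bot =>
    rw [EReal.bot_div_of_pos_ne_top ht' (EReal.coe_ne_top t), EReal.bot_add] at h
    have := EReal.add_eq_bot_iff.1 h.symm
    simp at this
  | top =>
    rw [EReal.top_div_of_pos_ne_top ht' (EReal.coe_ne_top t), EReal.top_add_coe] at h
    have hp : p = ⊤ := by
      by_contra hp
      lift p to NNReal using hp
      exact EReal.coe_ne_top (w + (p : ℝ)) (by rw [EReal.coe_add]; exact h.symm)
    rw [hp, ENNReal.mul_top (by simpa using ht), EReal.top_add_coe, EReal.coe_ennreal_top,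
      EReal.coe_add_top]
  | coe r =>
    induction p using ENNReal.recTopCoe with
    | top =>
      rw [EReal.coe_ennreal_top, EReal.coe_add_top, ← EReal.coe_div, ← EReal.coe_add] at h
      exact absurd h (EReal.coe_ne_top _)
    | coe a =>
      have e : ((a : ℝ≥0∞) : EReal) = ((a : ℝ) : EReal) := rfl
      rw [e, ← EReal.coe_div, ← EReal.coe_add, ← EReal.coe_add] at h
      have h' : r / t + m = w + a := by exact_mod_cast h
      rw [EReal.coe_ennreal_mul, e, coe_ofReal_of_nonneg ht.le, ← EReal.coe_mul, ← EReal.coe_add,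
        ← EReal.coe_add]
      congr 1
      have : t * (r / t + m) = t * (w + a) := by rw [h']
      rw [mul_add, mul_div_cancel₀ _ ht.ne'] at this
      linarith

/-! ### Weighted energies and their comparison -/

lemma IsMeasureOnWithMass.isFiniteMeasure {S : Set ℂ} {t : ℝ} {σ : Measure ℂ}
    (h : IsMeasureOnWithMass S t σ) : IsFiniteMeasure σ :=
  ⟨by rw [h.2]; exact ENNReal.ofReal_lt_top⟩

lemma IsMeasureOnWithMass.ae_mem {S : Set ℂ} {t : ℝ} {σ : Measure ℂ}
    (h : IsMeasureOnWithMass S t σ) : ∀ᵐ z ∂σ, z ∈ S :=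
  mem_ae_iff.2 h.1

/-- The two weights supplied by `Q / t` are exactly those that turn the logarithmic kernel into the
spherical one. Only a finite constant is subtracted, so infinite energies are covered. -/
lemma weightedEnergy_eq_sub {S : Set ℂ} {t : ℝ} {Q : ℂ → EReal} {m : ℝ} {P : ℂ → ℝ≥0∞}
    (hm : 0 ≤ m) (hP : Measurable P)
    (hQP : ∀ z ∈ S, Q z / (t : EReal) + (m : EReal) = (weight z : EReal) + (P z : EReal))
    {σ : Measure ℂ} (hσ : IsMeasureOnWithMass S t σ) :
    weightedEnergy t Q σ =
      ((mutualEnergy σ σ + 2 * (ENNReal.ofReal t * ∫⁻ z, P z ∂σ) : ℝ≥0∞) : EReal) -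
        ((ENNReal.ofReal (m + m) * (ENNReal.ofReal t * ENNReal.ofReal t) : ℝ≥0∞) : EReal) := by
  have := hσ.isFiniteMeasure
  have hκ := measurable_sphericalKernel
  have e1 : ∫⁻ p, (sphericalKernel p.1 p.2 + (P p.1 + P p.2)) ∂(σ.prod σ) =
      mutualEnergy σ σ + 2 * (ENNReal.ofReal t * ∫⁻ z, P z ∂σ) := by
    rw [lintegral_add_left hκ, lintegral_add_left (by fun_prop), mutualEnergy,
      lintegral_prod (fun p : ℂ × ℂ => P p.1) (by fun_prop),
      lintegral_prod (fun p : ℂ × ℂ => P p.2) (by fun_prop)]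
    simp only [lintegral_const]
    rw [lintegral_mul_const _ hP, hσ.2]
    ring
  have e2 : ∫⁻ _p, ENNReal.ofReal (m + m) ∂(σ.prod σ) =
      ENNReal.ofReal (m + m) * (ENNReal.ofReal t * ENNReal.ofReal t) := by
    rw [lintegral_const, ← Set.univ_prod_univ, Measure.prod_prod, hσ.2]
  rw [← e1, ← e2, weightedEnergy]
  refine eintegral_eq_sub (by fun_prop) (by fun_prop) ?_ ?_
  · rw [e2]
    finiteness
  · filter_upwards [Measure.quasiMeasurePreserving_fst.ae hσ.ae_mem,
      Measure.quasiMeasurePreserving_snd.ae hσ.ae_mem] with p h1 h2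
    rw [coe_ofReal_of_nonneg (add_nonneg hm hm), EReal.coe_ennreal_add, EReal.coe_ennreal_add,
      ← logKernel_add_weight, EReal.coe_ennreal_add, coe_ofReal_of_nonneg (weight_nonneg _),
      coe_ofReal_of_nonneg (weight_nonneg _), EReal.coe_add]
    calc _ = logKernel p.1 p.2 + (Q p.1 / t + m) + (Q p.2 / t + m) := by
          abel
      _ = _ := by
          rw [hQP _ h1, hQP _ h2]
          abel

/-- Since `μ` has mass exactly `t`, the term `-t * weight z` in its potential cancels `t * weight z`
in `Q`. -/
lemma potential_add_field {S : Set ℂ} {t : ℝ} (ht : 0 < t) {Q : ℂ → EReal} {m : ℝ}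
    {P : ℂ → ℝ≥0∞}
    (hQP : ∀ z ∈ S, Q z / (t : EReal) + (m : EReal) = (weight z : EReal) + (P z : EReal))
    {μ : Measure ℂ} (hμ : IsMeasureOnWithMass S t μ) (hfin : HasFiniteEnergy μ) {z : ℂ}
    (hz : z ∈ S) :
    potential μ z + Q z + ((t * m + (∫⁻ w, ENNReal.ofReal (weight w) ∂μ).toReal : ℝ) : EReal) =
      ((sphericalPotential μ z + ENNReal.ofReal t * P z : ℝ≥0∞) : EReal) := by
  have := hμ.isFiniteMeasure
  have hH := lintegral_weight_ne_top hfin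
  have hV := potential_eq_sub hfin z
  have hq := add_mul_eq_of_div_add_eq ht (hQP z hz)
  rw [hμ.2, EReal.coe_ennreal_add, EReal.coe_ennreal_mul, coe_ofReal_of_nonneg (weight_nonneg _),
    coe_ofReal_of_nonneg ht.le, ← EReal.coe_toReal (x := ((∫⁻ w, ENNReal.ofReal (weight w) ∂μ :
      ℝ≥0∞) : EReal)) (by simpa using hH) (by simp), EReal.toReal_coe_ennreal,
    ← EReal.coe_mul, ← EReal.coe_add] at hV
  have hV' := congrArg (· + ((weight z * t + (∫⁻ w, ENNReal.ofReal (weight w) ∂μ).toReal : ℝ) :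
    EReal)) hV
  simp only [EReal.sub_add_cancel] at hV'
  rw [EReal.coe_ennreal_add, ← hV', EReal.coe_add, EReal.coe_add]
  generalize (∫⁻ w, ENNReal.ofReal (weight w) ∂μ).toReal = H at *
  calc _ = potential μ z + (Q z + ((t * m : ℝ) : EReal)) + (H : EReal) := by abel
    _ = _ := by
      rw [hq, mul_comm (weight z) t]
      abel

/-- The comparison of weighted energies, with the Gaussian energy of the difference as
remainder. -/
lemma energy_add_gap_le {μ ν : Measure ℂ} [IsFiniteMeasure μ] [IsFiniteMeasure ν]
    (hm : μ Set.univ = ν Set.univ) (hμ : mutualEnergy μ μ ≠ ⊤) (hν : mutualEnergy ν ν ≠ ⊤)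
    {P : ℂ → ℝ≥0∞} (hP : Measurable P) {T c : ℝ≥0∞}
    (hle : ∀ᵐ z ∂μ, sphericalPotential μ z + T * P z ≤ c)
    (hge : ∀ᵐ z ∂ν, c ≤ sphericalPotential μ z + T * P z) :
    mutualEnergy μ μ + 2 * (T * ∫⁻ z, P z ∂μ) + ENNReal.ofReal (1 / 2) * gaussGap (1 / 2) 2 ν μ ≤
      mutualEnergy ν ν + 2 * (T * ∫⁻ z, P z ∂ν) := by
  have hU := measurable_sphericalPotential μ
  have h1 : mutualEnergy μ μ + T * ∫⁻ z, P z ∂μ ≤ c * μ Set.univ := by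
    rw [mutualEnergy_eq_lintegral, ← lintegral_const_mul _ hP, ← lintegral_add_left hU,
      ← lintegral_const]
    exact lintegral_mono_ae hle
  have h2 : c * ν Set.univ ≤ mutualEnergy ν μ + T * ∫⁻ z, P z ∂ν := by
    rw [mutualEnergy_eq_lintegral, ← lintegral_const_mul _ hP, ← lintegral_add_left hU,
      ← lintegral_const]
    exact lintegral_mono_ae hge
  have h3 := two_mul_mutualEnergy_add_le ν μ hm.symm hν hμ
  rw [hm] at h1
  have h12 := h1.trans h2
  -- Adding the finite energy of `μ` to both sides replaces the subtraction in the expansion of `I(ν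
  -- - μ)`.
  refine (ENNReal.add_le_add_iff_right hμ).1 ?_
  generalize ENNReal.ofReal (1 / 2) * gaussGap (1 / 2) 2 ν μ = d at *
  calc _ = 2 * (mutualEnergy μ μ + T * ∫⁻ z, P z ∂μ) + d := by ring
    _ ≤ 2 * (mutualEnergy ν μ + T * ∫⁻ z, P z ∂ν) + d := by gcongr
    _ = (2 * mutualEnergy ν μ + d) + 2 * (T * ∫⁻ z, P z ∂ν) := by ring
    _ ≤ (mutualEnergy ν ν + mutualEnergy μ μ) + 2 * (T * ∫⁻ z, P z ∂ν) := by gcongr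
    _ = _ := by ring

lemma le_of_coe_sub_le_coe_sub {x y c : ℝ≥0∞} (hc : c ≠ ⊤)
    (h : (x : EReal) - (c : EReal) ≤ (y : EReal) - (c : EReal)) : x ≤ y := by
  lift c to NNReal using hc
  have e : ((c : ℝ≥0∞) : EReal) = ((c : ℝ) : EReal) := rfl
  rw [e] at h
  have := add_le_add_left h ((c : ℝ) : EReal)
  rw [EReal.sub_add_cancel, EReal.sub_add_cancel] at this
  exact_mod_cast this

end WeightedPotential

/-! ### The equilibrium measure -/

open WeightedPotential in
theorem mainTheorem9 (S : Set ℂ) (hS : IsClosed S) (t : ℝ) (ht : 0 < t) (Q : ℂ → EReal)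
    (hQ : WeightedPotential.IsWeaklyAdmissible S t Q)
    (μ : Measure ℂ) (hμ : WeightedPotential.IsMeasureOnWithMass S t μ)
    (hfin : WeightedPotential.HasFiniteEnergy μ) (C : ℝ)
    (hge : WeightedPotential.QuasiEverywhereOn S
      (fun z => (C : EReal) ≤ WeightedPotential.potential μ z + Q z))
    (hle : WeightedPotential.QuasiEverywhereOn μ.support
      (fun z => WeightedPotential.potential μ z + Q z ≤ (C : EReal))) :
    WeightedPotential.IsEquilibriumMeasure S t Q μ ∧
      ∀ ν : Measure ℂ, WeightedPotential.IsEquilibriumMeasure S t Q ν → ν = μ := by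
  obtain ⟨m, P, hm, hP, hQP⟩ := hQ.exists_excess hS ht
  have := hμ.isFiniteMeasure
  have hEμ := mutualEnergy_self_ne_top hfin
  have hU := measurable_sphericalPotential μ
  have hVQ : ∀ z ∈ S, _ := fun z hz => potential_add_field ht hQP hμ hfin hz
  generalize t * m + (∫⁻ w, ENNReal.ofReal (weight w) ∂μ).toReal = k at hVQ
  set T := ENNReal.ofReal t
  -- Truncating `C + k` at zero is harmless: it is compared with `[0, ∞]`-valued functions only.
  set c := ENNReal.ofReal (C + k)
  have hUP : Measurable (fun z => sphericalPotential μ z + T * P z) := by fun_prop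
  have hμle : ∀ᵐ z ∂μ, sphericalPotential μ z + T * P z ≤ c := by
    -- The exceptional set is rewritten through the measurable spherical potential and `P`, which
    -- represent `V^μ + Q` only on `S`.
    have hA : MeasurableSet {z | z ∈ S ∩ μ.support ∧ c < sphericalPotential μ z + T * P z} :=
      (hS.measurableSet.inter Measure.isClosed_support.measurableSet).inter
        (measurableSet_lt measurable_const hUP)
    have hsub : {z | z ∈ S ∩ μ.support ∧ c < sphericalPotential μ z + T * P z} ⊆
        {z ∈ μ.support | ¬ potential μ z + Q z ≤ (C : EReal)} := by
      refine fun z hz => ⟨hz.1.2, fun h => ?_⟩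
      have h1 := add_le_add_left h (k : EReal)
      rw [hVQ z hz.1.1, ← EReal.coe_add] at h1
      have h2 := EReal.toENNReal_le_toENNReal h1
      rw [EReal.toENNReal_coe, EReal.real_coe_toENNReal] at h2
      exact absurd hz.2 (not_lt.2 h2)
    have h0 := measure_eq_zero_of_logCapacity_eq_zero hEμ hA hsub hle
    filter_upwards [hμ.ae_mem, Measure.support_mem_ae (μ := μ), measure_eq_zero_iff_ae_notMem.1 h0]
      with z h1 h2 h3
    exact not_lt.1 fun h => h3 ⟨⟨h1, h2⟩, h⟩
  have hνge : ∀ ν : Measure ℂ, IsMeasureOnWithMass S t ν → mutualEnergy ν ν ≠ ⊤ →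
      ∀ᵐ z ∂ν, c ≤ sphericalPotential μ z + T * P z := by
    intro ν hν hEν
    have := hν.isFiniteMeasure
    have hA : MeasurableSet {z | z ∈ S ∧ sphericalPotential μ z + T * P z < c} :=
      hS.measurableSet.inter (measurableSet_lt hUP measurable_const)
    have hsub : {z | z ∈ S ∧ sphericalPotential μ z + T * P z < c} ⊆
        {z ∈ S | ¬ (C : EReal) ≤ potential μ z + Q z} := by
      refine fun z hz => ⟨hz.1, fun h => ?_⟩
      have h1 := add_le_add_left h (k : EReal)
      rw [hVQ z hz.1, ← EReal.coe_add] at h1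
      have h2 := EReal.toENNReal_le_toENNReal h1
      rw [EReal.toENNReal_coe, EReal.real_coe_toENNReal] at h2
      exact absurd hz.2 (not_lt.2 h2)
    have h0 := measure_eq_zero_of_logCapacity_eq_zero hEν hA hsub hge
    filter_upwards [hν.ae_mem, measure_eq_zero_iff_ae_notMem.1 h0] with z h1 h2
    exact not_lt.1 fun h => h2 ⟨h1, h⟩
  have hgap : ∀ ν : Measure ℂ, IsMeasureOnWithMass S t ν → mutualEnergy ν ν ≠ ⊤ →
      mutualEnergy μ μ + 2 * (T * ∫⁻ z, P z ∂μ) +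
        ENNReal.ofReal (1 / 2) * gaussGap (1 / 2) 2 ν μ ≤
      mutualEnergy ν ν + 2 * (T * ∫⁻ z, P z ∂ν) := by
    intro ν hν hEν
    have := hν.isFiniteMeasure
    exact energy_add_gap_le (hμ.2.trans hν.2.symm) hEμ hEν hP hμle (hνge ν hν hEν)
  refine ⟨⟨hμ, fun ν hν => ?_⟩, fun ν hν => ?_⟩
  · rw [weightedEnergy_eq_sub hm hP hQP hμ, weightedEnergy_eq_sub hm hP hQP hν]
    refine EReal.sub_le_sub ?_ le_rfl
    rw [EReal.coe_ennreal_le_coe_ennreal_iff]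
    by_cases hEν : mutualEnergy ν ν = ⊤
    · rw [hEν, top_add]
      exact le_top
    · exact le_self_add.trans (hgap ν hν hEν)
  · have hle' := hν.2 μ hμ
    have := hν.1.isFiniteMeasure
    rw [weightedEnergy_eq_sub hm hP hQP hμ, weightedEnergy_eq_sub hm hP hQP hν.1] at hle'
    replace hle' := le_of_coe_sub_le_coe_sub (by finiteness) hle'
    -- The upper bound on `V^μ + Q` forces `∫ P dμ` to be finite. Hence any other minimizer has
    -- finite energy, and the remainder can be cancelled to zero.
    have hfinμ : mutualEnergy μ μ + 2 * (T * ∫⁻ z, P z ∂μ) ≠ ⊤ := by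
      have h1 : mutualEnergy μ μ + T * ∫⁻ z, P z ∂μ ≤ c * μ Set.univ := by
        rw [mutualEnergy_eq_lintegral, ← lintegral_const_mul _ hP, ← lintegral_add_left hU,
          ← lintegral_const]
        exact lintegral_mono_ae hμle
      have h2 : T * ∫⁻ z, P z ∂μ ≠ ⊤ := ne_top_of_le_ne_top
        (ENNReal.mul_ne_top ENNReal.ofReal_ne_top (measure_ne_top _ _)) (le_add_self.trans h1)
      exact ENNReal.add_ne_top.2 ⟨hEμ, ENNReal.mul_ne_top (by norm_num) h2⟩
    have hEν : mutualEnergy ν ν ≠ ⊤ :=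
      ne_top_of_le_ne_top hfinμ (le_self_add.trans hle')
    have h1 := (hgap ν hν.1 hEν).trans hle'
    have h2 : ENNReal.ofReal (1 / 2) * gaussGap (1 / 2) 2 ν μ = 0 := by
      by_contra h
      exact absurd h1 (not_le.2 (ENNReal.lt_add_right hfinμ h))
    rw [mul_eq_zero, or_iff_right (by norm_num)] at h2
    exact eq_of_gaussGap_eq_zero (by norm_num) ν μ h2
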